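/- **Setting.** Let $P_1,P_2,N>0$. All logarithms are natural and a rate pair is a pair $(R_1,R_2)$ of nonnegative reals. *Channel.* Consider the two-user channel $Y_t=X_{1,t}+X_{2,t}+Z_t$ with feedback outputs $V_{\nu,t}=Y_t+W_{\nu,t}$, $\nu\in\{1,2\}$, where $(Z_t)$ is IID $\mathcal N(0,N)$ and, independently, $((W_{1,t},W_{2,t}))$ is IID centered bivariate Gaussian with covariance matrix $\mathsf K$. A blocklength-$n$ feedback code consists of (measurable) encoders $X_{\nu,t}=\varphi_{\nu,t}(M_\nu,V_{\nu,1},\dots,V_{\nu,t-1})$ with independent messages $M_\nu$ uniform on finite sets $\mathcal M_\nu$ and independent of the noise, subject to $\frac1n\sum_{t=1}^n E[X_{\nu,t}^2]\le P_\nu$, and a (measurable) decoder $(Y_1,\dots,Y_n)\mapsto(\hat M_1,\hat M_2)$. A rate pair $(R_1,R_2)$ is achievable if for every $\delta>0$ there are such codes, for all sufficiently large $n$, with $\frac1n\log|\mathcal M_\nu|>R_\nu-\delta$ for $\nu=1,2$ and with average probability of decoding error tending to $0$ as $n\to\infty$. The set of achievable rate pairs for $\mathsf K=0$ is the perfect-feedback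 capacity region $\mathcal C_{\rm PerfectFB}(P_1,P_2,N)$. *Ozarow's rectangles.* Let $\rho^*=\rho^*(P_1,P_2,N)$ be the unique solution in $[0,1]$ of $$N\big(N+P_1+P_2+2\sqrt{P_1P_2}\,\rho\big)=\big(N+P_1(1-\rho^2)\big)\big(N+P_2(1-\rho^2)\big).$$ For $\rho\in[0,\rho^*]$ let $\mathcal R^\rho_{1,\rm Oz}(P_1,P_2,N)$ be the set of rate pairs with $$R_1\le\tfrac12\log\Big(1+\tfrac{P_1(1-\rho^2)}N\Big),\qquad R_2\le\tfrac12\log\frac{P_1+P_2+2\sqrt{P_1P_2}\,\rho+N}{P_1(1-\rho^2)+N},$$ and $\mathcal R^\rho_{2,\rm Oz}(P_1,P_2,N)$ the set of rate pairs with $$R_1\le\tfrac12\log\frac{P_1+P_2+2\sqrt{P_1P_2}\,\rho+N}{P_2(1-\rho^2)+N},\qquad R_2\le\tfrac12\log\Big(1+\tfrac{P_2(1-\rho^2)}N\Big).$$ *Concatenated-scheme regions.* Let $\eta\ge1$, $a_1,a_2\in\mathbb R^\eta$, let $B_1,B_2$ be strictly lower-triangular $\eta\times\eta$ matrices, let $C\in\mathbb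 R^{2\times\eta}$, and let $\mathsf K\succeq0$ be $2\times2$. Put $A=(a_1\ a_2)$, $\bar B=(B_1\ B_2)$ and $Q_{N,\mathsf K}=N I_\eta+\bar B(\mathsf K\otimes I_\eta)\bar B^{\mathsf T}$. If $CC^{\mathsf T}$ is nonsingular, $\mathcal R_{N,\mathsf K}(\eta,a_1,a_2,B_1,B_2,C)$ is the set of rate pairs with $$R_\nu\le\frac1{2\eta}\log\frac{|C(a_\nu a_\nu^{\mathsf T}+Q_{N,\mathsf K})C^{\mathsf T}|}{|CQ_{N,\mathsf K}C^{\mathsf T}|}\ (\nu=1,2),\qquad R_1+R_2\le\frac1{2\eta}\log\frac{|C(AA^{\mathsf T}+Q_{N,\mathsf K})C^{\mathsf T}|}{|CQ_{N,\mathsf K}C^{\mathsf T}|};$$ if $CC^{\mathsf T}$ is singular but $C\ne0$, it is defined by the same inequalities with $C$ replaced by one of its nonzero rows; if $C=0$, it is $\{(0,0)\}$. The parameters satisfy the trace constraints for $(P_1,P_2,N,\mathsf K)$ if, for $\nu=1,2$, the $\nu$-th diagonal $\eta\times\eta$ block of $$(I_{2\eta}-\mathbf B)^{-1}\Big(A_dA_d^{\mathsf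 T}+N\begin{pmatrix}B_1\\B_2\end{pmatrix}\begin{pmatrix}B_1\\B_2\end{pmatrix}^{\mathsf T}+B_d(\mathsf K\otimes I_\eta)B_d^{\mathsf T}\Big)(I_{2\eta}-\mathbf B)^{-\mathsf T},\quad \mathbf B=\begin{pmatrix}B_1&B_1\\B_2&B_2\end{pmatrix},\ A_d=\begin{pmatrix}a_1&0\\0&a_2\end{pmatrix},\ B_d=\begin{pmatrix}B_1&0\\0&B_2\end{pmatrix},$$ has trace at most $\eta P_\nu$. *Rate-splitting regions.* $\mathcal R_{\rm RS,1}(P_1',P_1'',P_2,N,\mathsf K)$ is the closure of the union, over all $(\eta,a_1,a_2,B_1,B_2,C)$ satisfying the trace constraints for $(P_1'',P_2,N+P_1',\mathsf K)$, of the sets of pairs $(R_{\rm CS}+R_{\rm NF},R_2)$ with $R_{\rm CS},R_{\rm NF}\ge0$, $(R_{\rm CS},R_2)\in\mathcal R_{N+P_1',\mathsf K}(\eta,a_1,a_2,B_1,B_2,C)$ and $$R_{\rm NF}\le\frac1{2\eta}\log\frac{|P_1'I_\eta+Q_{N,\mathsf K}|}{|Q_{N,\mathsf K}|}.$$ $\mathcal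 R_{\rm RS,2}(P_1,P_2',P_2'',N,\mathsf K)$ is defined in the same way with the roles of the two users exchanged (trace constraints for $(P_1,P_2'',N+P_2',\mathsf K)$, and $R_2$ split). **Proposition (Convergence to the boundary of $\mathcal C_{\rm PerfectFB}$).** 1. For every $\rho\in[0,\rho^*]$ there is $P_1'(\rho)\in[0,P_1]$ such that $$\mathrm{cl}\Big(\bigcup_{\sigma^2>0}\ \bigcap_{\mathsf K\succeq0,\ \mathrm{tr}\,\mathsf K\le\sigma^2}\mathcal R_{\rm RS,1}\big(P_1'(\rho),P_1-P_1'(\rho),P_2,N,\mathsf K\big)\Big)\supseteq\mathcal R^\rho_{1,\rm Oz}(P_1,P_2,N).$$ 2. For every $\rho\in[0,\rho^*]$ there is $P_2'(\rho)\in[0,P_2]$ such that $$\mathrm{cl}\Big(\bigcup_{\sigma^2>0}\ \bigcap_{\mathsf K\succeq0,\ \mathrm{tr}\,\mathsf K\le\sigma^2}\mathcal R_{\rm RS,2}\big(P_1,P_2'(\rho),P_2-P_2'(\rho),N,\mathsf K\big)\Big)\supseteq\mathcal R^\rho_{2,\rm Oz}(P_1,P_2,N).$$ 3. Consequently the rate-splitting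 regions asymptotically approach all boundary points of $\mathcal C_{\rm PerfectFB}(P_1,P_2,N)$: every boundary point (in $\mathbb R^2$) of $\mathcal C_{\rm PerfectFB}(P_1,P_2,N)$ belongs, for some $P_1'\in[0,P_1]$, to $\mathrm{cl}\big(\bigcup_{\sigma^2>0}\bigcap_{\mathsf K\succeq0,\,\mathrm{tr}\,\mathsf K\le\sigma^2}\mathcal R_{\rm RS,1}(P_1',P_1-P_1',P_2,N,\mathsf K)\big)$ or, for some $P_2'\in[0,P_2]$, to $\mathrm{cl}\big(\bigcup_{\sigma^2>0}\bigcap_{\mathsf K\succeq0,\,\mathrm{tr}\,\mathsf K\le\sigma^2}\mathcal R_{\rm RS,2}(P_1,P_2',P_2-P_2',N,\mathsf K)\big)$. -/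

import Mathlib

open scoped Matrix Kronecker Topology

noncomputable section

namespace AWGNMAC

/-! ### The two-user Gaussian multiple-access channel with noisy feedback

Users are indexed by `Fin 2` (index `0` is Transmitter 1, index `1` is Transmitter 2).
All logarithms are natural. A rate pair is a pair of nonnegative reals. -/

/-- A blocklength-`n` feedback code with message sets of sizes `M 0` and `M 1`: at time `t`,
Transmitter `ν` maps its message and its `t` previous feedback outputs to a channel input. -/
structure FeedbackCode (n : ℕ) (M : Fin 2 → ℕ) where
  card_pos : ∀ ν, 0 < M ν
  enc : (ν : Fin 2) → (t : Fin n) → Fin (M ν) → (Fin (t : ℕ) → ℝ) → ℝ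
  dec : (Fin n → ℝ) → ((ν : Fin 2) → Fin (M ν))
  measurable_enc : ∀ ν t m, Measurable (enc ν t m)
  measurable_dec : Measurable dec

namespace FeedbackCode

variable {n : ℕ} {M : Fin 2 → ℕ}

/-- The channel output `Y_t = X_{1,t} + X_{2,t} + Z_t`, where `X_{ν,t}` is computed from the
message and the previous feedback outputs `V_{ν,s} = Y_s + W_{ν,s}`, `s < t`. -/
def output (c : FeedbackCode n M) (m : (ν : Fin 2) → Fin (M ν)) (z : Fin n → ℝ)
    (w : Fin n → EuclideanSpace ℝ (Fin 2)) (t : Fin n) : ℝ :=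
  (∑ ν : Fin 2, c.enc ν t (m ν) fun s : Fin (t : ℕ) =>
    c.output m z w ⟨s, s.2.trans t.2⟩ + w ⟨s, s.2.trans t.2⟩ ν) + z t
termination_by (t : ℕ)
decreasing_by exact s.2

/-- The channel input `X_{ν,t}`. -/
def input (c : FeedbackCode n M) (m : (ν : Fin 2) → Fin (M ν)) (z : Fin n → ℝ)
    (w : Fin n → EuclideanSpace ℝ (Fin 2)) (ν : Fin 2) (t : Fin n) : ℝ :=
  c.enc ν t (m ν) fun s : Fin (t : ℕ) =>
    c.output m z w ⟨s, s.2.trans t.2⟩ + w ⟨s, s.2.trans t.2⟩ ν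

end FeedbackCode

/-- The law of the noise: `Z_t` IID centered Gaussian of variance `N` and, independently,
`(W_{1,t}, W_{2,t})` IID centered bivariate Gaussian with covariance matrix `K`. -/
def noiseLaw (n : ℕ) (N : ℝ) (K : Matrix (Fin 2) (Fin 2) ℝ) :
    MeasureTheory.Measure ((Fin n → ℝ) × (Fin n → EuclideanSpace ℝ (Fin 2))) :=
  (MeasureTheory.Measure.pi fun _ => ProbabilityTheory.gaussianReal 0 N.toNNReal).prod
    (MeasureTheory.Measure.pi fun _ => ProbabilityTheory.multivariateGaussian 0 K)

namespace FeedbackCode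

variable {n : ℕ} {M : Fin 2 → ℕ}

/-- Expected average block-power constraint of Transmitter `ν`, the expectation being over
uniform independent messages and over the noise. -/
def PowerConstraint (c : FeedbackCode n M) (N : ℝ) (K : Matrix (Fin 2) (Fin 2) ℝ)
    (ν : Fin 2) (P : ℝ) : Prop :=
  (∀ m t, MeasureTheory.MemLp (fun ω => c.input m ω.1 ω.2 ν t) 2 (noiseLaw n N K)) ∧
  (1 / (n : ℝ)) * ∑ t : Fin n, (1 / ((M 0 : ℝ) * M 1)) * ∑ m : (ν : Fin 2) → Fin (M ν),
    ∫ ω, (c.input m ω.1 ω.2 ν t) ^ 2 ∂(noiseLaw n N K) ≤ P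

/-- Average probability of a decoding error. -/
def errorProb (c : FeedbackCode n M) (N : ℝ) (K : Matrix (Fin 2) (Fin 2) ℝ) : ℝ :=
  (1 / ((M 0 : ℝ) * M 1)) * ∑ m : (ν : Fin 2) → Fin (M ν),
    (noiseLaw n N K).real {ω | c.dec (c.output m ω.1 ω.2) ≠ m}

end FeedbackCode

/-- The capacity region with noisy feedback: the set of all achievable rate pairs. -/
def capNoisyFB (P₁ P₂ N : ℝ) (K : Matrix (Fin 2) (Fin 2) ℝ) : Set (ℝ × ℝ) :=
  {R | 0 ≤ R.1 ∧ 0 ≤ R.2 ∧ ∀ δ > 0,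
    ∃ (M : ℕ → Fin 2 → ℕ) (c : (n : ℕ) → FeedbackCode n (M n)),
      (∀ᶠ n : ℕ in Filter.atTop,
        (c n).PowerConstraint N K 0 P₁ ∧ (c n).PowerConstraint N K 1 P₂ ∧
        R.1 - δ < (1 / (n : ℝ)) * Real.log (M n 0) ∧
        R.2 - δ < (1 / (n : ℝ)) * Real.log (M n 1)) ∧
      Filter.Tendsto (fun n => (c n).errorProb N K) Filter.atTop (𝓝 0)}

/-- The capacity region with perfect (noise-free) feedback. -/
def capPerfectFB (P₁ P₂ N : ℝ) : Set (ℝ × ℝ) := capNoisyFB P₁ P₂ N 0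

/-! ### Ozarow's rectangles -/

/-- The defining equation of `ρ*`. -/
def RhoEq (P₁ P₂ N ρ : ℝ) : Prop :=
  N * (N + P₁ + P₂ + 2 * √(P₁ * P₂) * ρ) =
    (N + P₁ * (1 - ρ ^ 2)) * (N + P₂ * (1 - ρ ^ 2))

theorem existsUnique_rhoEq {P₁ P₂ N : ℝ} (h₁ : 0 < P₁) (h₂ : 0 < P₂) (hN : 0 < N) :
    ∃! ρ : ℝ, ρ ∈ Set.Icc (0 : ℝ) 1 ∧ RhoEq P₁ P₂ N ρ := by
  have hs : 0 < √(P₁ * P₂) := Real.sqrt_pos.2 (mul_pos h₁ h₂)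
  have hanti : StrictAntiOn (fun ρ : ℝ => (N + P₁ * (1 - ρ ^ 2)) * (N + P₂ * (1 - ρ ^ 2))
      - N * (N + P₁ + P₂ + 2 * √(P₁ * P₂) * ρ)) (Set.Icc 0 1) := by
    intro x hx y hy hxy
    have hsq : x ^ 2 ≤ y ^ 2 := pow_le_pow_left₀ hx.1 hxy.le 2
    have hy2 : y ^ 2 ≤ 1 := pow_le_one₀ hy.1 hy.2
    have e1 : (N + P₁ * (1 - y ^ 2)) * (N + P₂ * (1 - y ^ 2)) ≤
        (N + P₁ * (1 - x ^ 2)) * (N + P₂ * (1 - x ^ 2)) := by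
      apply mul_le_mul
      · nlinarith
      · nlinarith
      · nlinarith
      · nlinarith
    have e2 : N * (2 * √(P₁ * P₂) * x) < N * (2 * √(P₁ * P₂) * y) := by gcongr
    simp only
    nlinarith
  have hcont : ContinuousOn (fun ρ : ℝ => (N + P₁ * (1 - ρ ^ 2)) * (N + P₂ * (1 - ρ ^ 2))
      - N * (N + P₁ + P₂ + 2 * √(P₁ * P₂) * ρ)) (Set.Icc 0 1) := by fun_prop
  have h0 : (0 : ℝ) ∈ Set.Icc
      ((fun ρ : ℝ => (N + P₁ * (1 - ρ ^ 2)) * (N + P₂ * (1 - ρ ^ 2))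
      - N * (N + P₁ + P₂ + 2 * √(P₁ * P₂) * ρ)) 1)
      ((fun ρ : ℝ => (N + P₁ * (1 - ρ ^ 2)) * (N + P₂ * (1 - ρ ^ 2))
      - N * (N + P₁ + P₂ + 2 * √(P₁ * P₂) * ρ)) 0) := by
    have := mul_pos h₁ h₂
    have := mul_pos hN hs
    have := mul_pos hN h₁
    have := mul_pos hN h₂
    constructor <;> simp only <;> nlinarith
  obtain ⟨ρ, hρ, hρ0⟩ := intermediate_value_Icc' zero_le_one hcont h0
  refine ⟨ρ, ⟨hρ, (sub_eq_zero.1 hρ0).symm⟩, ?_⟩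
  rintro y ⟨hy, hye⟩
  exact hanti.injOn hy hρ (Eq.trans (sub_eq_zero.2 (Eq.symm hye)) hρ0.symm)

/-- `ρ*(P₁, P₂, N)`: the solution of `RhoEq` in `[0, 1]`; it exists and is unique for positive
`P₁, P₂, N` by `existsUnique_rhoEq`. -/
def rhoStar (P₁ P₂ N : ℝ) : ℝ :=
  Classical.epsilon fun ρ : ℝ => ρ ∈ Set.Icc (0 : ℝ) 1 ∧ RhoEq P₁ P₂ N ρ

theorem rhoStar_spec {P₁ P₂ N : ℝ} (h₁ : 0 < P₁) (h₂ : 0 < P₂) (hN : 0 < N) :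
    rhoStar P₁ P₂ N ∈ Set.Icc (0 : ℝ) 1 ∧ RhoEq P₁ P₂ N (rhoStar P₁ P₂ N) :=
  Classical.epsilon_spec (existsUnique_rhoEq h₁ h₂ hN).exists

/-- Ozarow's rectangle `R^ρ_{1,Oz}`. -/
def ozRect₁ (P₁ P₂ N ρ : ℝ) : Set (ℝ × ℝ) :=
  {R | 0 ≤ R.1 ∧ 0 ≤ R.2 ∧
    R.1 ≤ 1 / 2 * Real.log (1 + P₁ * (1 - ρ ^ 2) / N) ∧
    R.2 ≤ 1 / 2 * Real.log ((P₁ + P₂ + 2 * √(P₁ * P₂) * ρ + N) / (P₁ * (1 - ρ ^ 2) + N))}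

/-- Ozarow's rectangle `R^ρ_{2,Oz}`. -/
def ozRect₂ (P₁ P₂ N ρ : ℝ) : Set (ℝ × ℝ) :=
  {R | 0 ≤ R.1 ∧ 0 ≤ R.2 ∧
    R.1 ≤ 1 / 2 * Real.log ((P₁ + P₂ + 2 * √(P₁ * P₂) * ρ + N) / (P₂ * (1 - ρ ^ 2) + N)) ∧
    R.2 ≤ 1 / 2 * Real.log (1 + P₂ * (1 - ρ ^ 2) / N)}

/-! ### The concatenated scheme

Vectors of length `2η` are indexed by `Fin 2 × Fin η`: the entry `(ν, i)` is the `i`-th entry of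
the `ν`-th block of length `η`. -/

/-- Parameters of the scheme for a given `η`: vectors `a_ν`, strictly lower-triangular matrices
`B_ν`, and a `2 × η` matrix `C`. -/
structure Params (η : ℕ) where
  a : Fin 2 → Fin η → ℝ
  B : Fin 2 → Matrix (Fin η) (Fin η) ℝ
  C : Matrix (Fin 2) (Fin η) ℝ
  strictLower : ∀ ν i j, i ≤ j → B ν i j = 0

namespace Params

variable {η : ℕ}

/-- The `η × 2` matrix `(a₁ a₂)`. -/
def Ab (p : Params η) : Matrix (Fin η) (Fin 2) ℝ := Matrix.of fun i ν => p.a ν i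

/-- The `2η × 2` block-diagonal matrix with blocks `a₁, a₂`. -/
def Ad (p : Params η) : Matrix (Fin 2 × Fin η) (Fin 2) ℝ :=
  Matrix.of fun x μ => if x.1 = μ then p.a x.1 x.2 else 0

/-- The `η × 2η` matrix `(B₁ B₂)`. -/
def Bb (p : Params η) : Matrix (Fin η) (Fin 2 × Fin η) ℝ := Matrix.of fun i y => p.B y.1 i y.2

/-- The `2η × η` matrix with `B₁` on top of `B₂`. -/
def Bt (p : Params η) : Matrix (Fin 2 × Fin η) (Fin η) ℝ := Matrix.of fun x j => p.B x.1 x.2 j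

/-- The `2η × 2η` block-diagonal matrix with blocks `B₁, B₂`. -/
def Bd (p : Params η) : Matrix (Fin 2 × Fin η) (Fin 2 × Fin η) ℝ :=
  Matrix.of fun x y => if x.1 = y.1 then p.B x.1 x.2 y.2 else 0

/-- The `2η × 2η` matrix with block rows `(B₁ B₁)` and `(B₂ B₂)`. -/
def BB (p : Params η) : Matrix (Fin 2 × Fin η) (Fin 2 × Fin η) ℝ :=
  Matrix.of fun x y => p.B x.1 x.2 y.2

/-- `N I_η + (B₁ B₂)(K ⊗ I_η)(B₁ B₂)ᵀ`. -/
def noiseCov (p : Params η) (N : ℝ) (K : Matrix (Fin 2) (Fin 2) ℝ) :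
    Matrix (Fin η) (Fin η) ℝ :=
  N • (1 : Matrix (Fin η) (Fin η) ℝ) +
    p.Bb * (K ⊗ₖ (1 : Matrix (Fin η) (Fin η) ℝ)) * p.Bbᵀ

/-- `(1/(2η)) log (|D (S + Q) Dᵀ| / |D Q Dᵀ|)`, with `Q` the noise covariance. -/
def rateBound (p : Params η) (N : ℝ) (K : Matrix (Fin 2) (Fin 2) ℝ) {k : ℕ}
    (D : Matrix (Fin k) (Fin η) ℝ) (S : Matrix (Fin η) (Fin η) ℝ) : ℝ :=
  1 / (2 * (η : ℝ)) *
    Real.log ((D * (S + p.noiseCov N K) * Dᵀ).det / (D * p.noiseCov N K * Dᵀ).det)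

/-- The rate pairs satisfying the three rate constraints with decoding matrix `D`. -/
def constraintSet (p : Params η) (N : ℝ) (K : Matrix (Fin 2) (Fin 2) ℝ) {k : ℕ}
    (D : Matrix (Fin k) (Fin η) ℝ) : Set (ℝ × ℝ) :=
  {R | 0 ≤ R.1 ∧ 0 ≤ R.2 ∧
    R.1 ≤ p.rateBound N K D (Matrix.vecMulVec (p.a 0) (p.a 0)) ∧
    R.2 ≤ p.rateBound N K D (Matrix.vecMulVec (p.a 1) (p.a 1)) ∧
    R.1 + R.2 ≤ p.rateBound N K D (p.Ab * p.Abᵀ)}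

/-- The rate region of the concatenated scheme with parameters `p`. If `C Cᵀ` is singular but
`C ≠ 0`, the matrix `C` is replaced by one of its nonzero rows; if `C = 0`, the region is the
origin. -/
def region (p : Params η) (N : ℝ) (K : Matrix (Fin 2) (Fin 2) ℝ) : Set (ℝ × ℝ) :=
  {R | ((p.C * p.Cᵀ).det ≠ 0 ∧ R ∈ p.constraintSet N K p.C) ∨
    ((p.C * p.Cᵀ).det = 0 ∧ ∃ ν : Fin 2, p.C ν ≠ 0 ∧
      R ∈ p.constraintSet N K (Matrix.of fun _ : Fin 1 => p.C ν)) ∨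
    (p.C = 0 ∧ R = (0, 0))}

/-- The covariance matrix of the stacked channel inputs,
`(I - BB)⁻¹ (A_d A_dᵀ + N B_t B_tᵀ + B_d (K ⊗ I_η) B_dᵀ) (I - BB)⁻ᵀ`. -/
def inputCov (p : Params η) (N : ℝ) (K : Matrix (Fin 2) (Fin 2) ℝ) :
    Matrix (Fin 2 × Fin η) (Fin 2 × Fin η) ℝ :=
  (1 - p.BB)⁻¹ *
    (p.Ad * p.Adᵀ + N • (p.Bt * p.Btᵀ) +
      p.Bd * (K ⊗ₖ (1 : Matrix (Fin η) (Fin η) ℝ)) * p.Bdᵀ) *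
    ((1 - p.BB)⁻¹)ᵀ

/-- The two trace constraints: the trace of the `ν`-th diagonal `η × η` block of `inputCov` is
at most `η P_ν`. -/
def TraceConstraints (p : Params η) (P₁ P₂ N : ℝ) (K : Matrix (Fin 2) (Fin 2) ℝ) : Prop :=
  ((p.inputCov N K).submatrix (Prod.mk 0) (Prod.mk 0)).trace ≤ η * P₁ ∧
  ((p.inputCov N K).submatrix (Prod.mk 1) (Prod.mk 1)).trace ≤ η * P₂

/-- The bound on the rate `R_NF` of the part of the message sent without feedback, with
power `P'`. -/
def nfBound (p : Params η) (P' N : ℝ) (K : Matrix (Fin 2) (Fin 2) ℝ) : ℝ :=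
  1 / (2 * (η : ℝ)) *
    Real.log ((P' • (1 : Matrix (Fin η) (Fin η) ℝ) + p.noiseCov N K).det /
      (p.noiseCov N K).det)

/-- Rate-splitting region for fixed parameters, Transmitter 1 splitting its message. -/
def regionRS₁ (p : Params η) (P₁' N : ℝ) (K : Matrix (Fin 2) (Fin 2) ℝ) : Set (ℝ × ℝ) :=
  {R | ∃ Rcs Rnf : ℝ, 0 ≤ Rcs ∧ 0 ≤ Rnf ∧ Rcs + Rnf = R.1 ∧
    (Rcs, R.2) ∈ p.region (N + P₁') K ∧ Rnf ≤ p.nfBound P₁' N K}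

/-- Rate-splitting region for fixed parameters, Transmitter 2 splitting its message. -/
def regionRS₂ (p : Params η) (P₂' N : ℝ) (K : Matrix (Fin 2) (Fin 2) ℝ) : Set (ℝ × ℝ) :=
  {R | ∃ Rcs Rnf : ℝ, 0 ≤ Rcs ∧ 0 ≤ Rnf ∧ Rcs + Rnf = R.2 ∧
    (R.1, Rcs) ∈ p.region (N + P₂') K ∧ Rnf ≤ p.nfBound P₂' N K}

end Params

/-- The rate-splitting region `R_{RS,1}(P₁', P₁'', P₂, N, K)`. -/
def rateRS₁ (P₁' P₁'' P₂ N : ℝ) (K : Matrix (Fin 2) (Fin 2) ℝ) : Set (ℝ × ℝ) :=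
  closure {R | ∃ (η : ℕ) (p : Params η), 0 < η ∧
    p.TraceConstraints P₁'' P₂ (N + P₁') K ∧ R ∈ p.regionRS₁ P₁' N K}

/-- The rate-splitting region `R_{RS,2}(P₁, P₂', P₂'', N, K)`. -/
def rateRS₂ (P₁ P₂' P₂'' N : ℝ) (K : Matrix (Fin 2) (Fin 2) ℝ) : Set (ℝ × ℝ) :=
  closure {R | ∃ (η : ℕ) (p : Params η), 0 < η ∧
    p.TraceConstraints P₁ P₂'' (N + P₂') K ∧ R ∈ p.regionRS₂ P₂' N K}

/-- The limit of a family of regions, indexed by feedback-noise covariance matrices, as the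
feedback-noise variances vanish irrespective of the correlation:
`cl (⋃_{σ² > 0} ⋂_{K ⪰ 0, tr K ≤ σ²} F(K))`. -/
def vanishingNoiseLimit (F : Matrix (Fin 2) (Fin 2) ℝ → Set (ℝ × ℝ)) : Set (ℝ × ℝ) :=
  closure (⋃ σsq ∈ Set.Ioi (0 : ℝ),
    ⋂ K ∈ {K : Matrix (Fin 2) (Fin 2) ℝ | K.PosSemidef ∧ K.trace ≤ σsq}, F K)

end AWGNMAC

end

/-! Achievability. Fix a correlation `ρ > 0` and split `P₁ = Q + P'`. The part of power `P'` is sent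
without feedback and is noise for the rest, so the cooperating part sees powers `Q, P₂` and noise `N
+ P'`. By continuity `Q` can be chosen so that the correlation `r` with `Q r² = P₁ ρ²` solves
`RhoEq` for these parameters (`exists_power_split`). The corner of Ozarow's rectangle for `ρ` is
then the full-cooperation corner for `(Q, P₂, N + P')` plus the rate of the non-feedback part
(`ozRect₁_split_rates`).

The full-cooperation corner is approached by Ozarow's scheme: each user keeps sending a scaled error
of the linear MMSE estimate of its own symbol. With alternating signs, `RhoEq` is exactly what keeps
the absolute correlation of the two errors constant. The posterior precisions therefore grow
geometrically at constant power, and the two single-user bounds and the sum bound become tight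
together (`precision_ozGain`, `exists_errorScheme`). For a fixed scheme all rates and powers are
continuous at `K = 0`, and strict slack at `K = 0` survives for all positive semidefinite `K` of
small trace, whatever the correlation (`exists_eventually_region`, `exists_forall_posSemidef`). The
case `ρ = 0` needs no feedback.

Boundary points. Only an outer bound on the capacity region is needed: a closed set containing the
region contains its frontier. The bound comes from a change of measure. The true output law of a
code is compared with an autoregressive Gaussian law that ignores one or both messages and under
which decoding therefore cannot beat guessing; the relative entropy of the two laws is explicit
(`log_mul_arLaw_sub_le`, `rate_le`). Choosing the reference predictor as a linear regression gives
the bounds in `ozOuter`, and an intermediate-value argument covers the nonnegative part of `ozOuter`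
by Ozarow's rectangles (`exists_mem_ozRect`). -/

noncomputable section

namespace AWGNMAC

open MeasureTheory ProbabilityTheory
open scoped ENNReal NNReal

/-! ### Autoregressive Gaussian densities -/

/-- The residuals `y_t - h_t(y_0, …, y_{t-1})` of a predictor `h`. -/
def residual {n : ℕ} (h : (t : Fin n) → (Fin (t : ℕ) → ℝ) → ℝ) (y : Fin n → ℝ) (t : Fin n) : ℝ :=
  y t - h t fun s => y ⟨s, s.2.trans t.2⟩

lemma measurable_residual {n : ℕ} {h : (t : Fin n) → (Fin (t : ℕ) → ℝ) → ℝ}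
    (hh : ∀ t, Measurable (h t)) : Measurable (residual h) := by
  refine measurable_pi_lambda _ fun t => ?_
  exact (measurable_pi_apply t).sub
    ((hh t).comp (measurable_pi_lambda _ fun s => measurable_pi_apply _))

/-- The map is a unipotent triangular shear: given its past, each coordinate is only translated.
Peeling off the last coordinate gives a skew product over the shorter map. -/
lemma measurePreserving_residual {n : ℕ} (h : (t : Fin n) → (Fin (t : ℕ) → ℝ) → ℝ)
    (hh : ∀ t, Measurable (h t)) :
    MeasurePreserving (residual h) (volume : Measure (Fin n → ℝ)) volume := by
  induction n with
  | zero =>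
    have : residual h = id := by ext y t; exact t.elim0
    rw [this]; exact MeasurePreserving.id _
  | succ n ih =>
    have e := volume_preserving_piFinSuccAbove (fun _ : Fin (n + 1) => ℝ) (Fin.last n)
    have hl : Measurable (h (Fin.last n)) := hh _
    have sk : MeasurePreserving (fun p : (Fin n → ℝ) × ℝ =>
        (residual (fun t : Fin n => h t.castSucc) p.1, p.2 - h (Fin.last n) p.1))
        (volume.prod volume) (volume.prod volume) := by
      refine (ih (fun t : Fin n => h t.castSucc) fun t => hh _).skew_product
        (g := fun y x => x - h (Fin.last n) y) ?_ (ae_of_all _ fun y => ?_)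
      · exact measurable_snd.sub (hl.comp measurable_fst)
      · exact (measurePreserving_sub_right volume (h (Fin.last n) y)).map_eq
    -- The swaps put the past first, as the skew product requires; `piFinSuccAbove` puts the removed
    -- coordinate first.
    have key := (((e.symm _).comp Measure.measurePreserving_swap).comp sk).comp
      (Measure.measurePreserving_swap.comp e)
    suffices hfun : residual h = _ from hfun ▸ key
    refine funext fun y => funext fun t => ?_
    refine Fin.lastCases ?_ (fun t => ?_) t
    · simp [residual, MeasurableEquiv.piFinSuccAbove, Fin.insertNthEquiv]
      rfl
    · simp [residual, MeasurableEquiv.piFinSuccAbove, Fin.insertNthEquiv]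
      rfl

lemma lintegral_fin_prod {n : ℕ} (f : Fin n → ℝ → ℝ≥0∞) (hf : ∀ i, Measurable (f i)) :
    ∫⁻ x : Fin n → ℝ, ∏ i, f i (x i) = ∏ i, ∫⁻ x, f i x := by
  induction n with
  | zero => simp [volume_pi]
  | succ n ih =>
    have e := (volume_preserving_piFinSuccAbove (fun _ : Fin (n + 1) => ℝ) 0).symm
    rw [← e.lintegral_comp (by fun_prop)]
    simp only [Fin.prod_univ_succ]
    have hm : Measurable fun y : Fin n → ℝ => ∏ i : Fin n, f i.succ (y i) :=
      Finset.measurable_prod _ fun i _ => (hf _).comp (measurable_pi_apply i)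
    rw [← ih _ fun i => hf _, Measure.volume_eq_prod,
      ← lintegral_prod_mul (hf 0).aemeasurable hm.aemeasurable]
    simp [MeasurableEquiv.piFinSuccAbove, Fin.insertNthEquiv]

lemma pi_gaussianReal_eq_withDensity (n : ℕ) {v : ℝ≥0} (hv : v ≠ 0) :
    Measure.pi (fun _ : Fin n => gaussianReal 0 v) =
      (volume : Measure (Fin n → ℝ)).withDensity fun y => ∏ t, gaussianPDF 0 v (y t) := by
  refine Measure.pi_eq fun s hs => ?_
  have hm : Measurable (gaussianPDF 0 v) := measurable_gaussianPDF 0 v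
  rw [withDensity_apply _ (MeasurableSet.univ_pi hs),
    ← lintegral_indicator (MeasurableSet.univ_pi hs)]
  have : ∀ y : Fin n → ℝ, (Set.univ.pi s).indicator (fun y => ∏ t, gaussianPDF 0 v (y t)) y =
      ∏ t, (s t).indicator (gaussianPDF 0 v) (y t) := by
    intro y
    by_cases hy : y ∈ Set.univ.pi s
    · rw [Set.indicator_of_mem hy]
      exact Finset.prod_congr rfl fun t _ => (Set.indicator_of_mem (hy t trivial) _).symm
    · rw [Set.indicator_of_notMem hy]
      simp only [Set.mem_univ_pi, not_forall] at hy
      obtain ⟨t, ht⟩ := hy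
      exact (Finset.prod_eq_zero (Finset.mem_univ t) (Set.indicator_of_notMem ht _)).symm
  simp_rw [this]
  rw [lintegral_fin_prod _ fun t => hm.indicator (hs t)]
  refine Finset.prod_congr rfl fun t _ => ?_
  rw [lintegral_indicator (hs t), gaussianReal_apply 0 hv]

/-- The density of the process whose residuals are IID centered Gaussian of variance `v`. -/
def arDensity {n : ℕ} (h : (t : Fin n) → (Fin (t : ℕ) → ℝ) → ℝ) (v : ℝ≥0) (y : Fin n → ℝ) : ℝ :=
  ∏ t, gaussianPDFReal 0 v (residual h y t)

/-- The law of the process whose residuals are IID centered Gaussian of variance `v`. -/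
def arLaw {n : ℕ} (h : (t : Fin n) → (Fin (t : ℕ) → ℝ) → ℝ) (v : ℝ≥0) : Measure (Fin n → ℝ) :=
  volume.withDensity fun y => ENNReal.ofReal (arDensity h v y)

section
variable {n : ℕ} {h k : (t : Fin n) → (Fin (t : ℕ) → ℝ) → ℝ}

lemma measurable_arDensity (hh : ∀ t, Measurable (h t)) (v : ℝ≥0) :
    Measurable (arDensity h v) := by
  have := measurable_residual hh
  unfold arDensity
  refine Finset.measurable_prod _ fun t _ => ?_
  exact (measurable_gaussianPDFReal 0 v).comp ((measurable_pi_apply t).comp this)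

lemma arDensity_pos {v : ℝ≥0} (hv : v ≠ 0) (y : Fin n → ℝ) : 0 < arDensity h v y :=
  Finset.prod_pos fun _ _ => gaussianPDFReal_pos 0 v _ hv

lemma ofReal_arDensity (v : ℝ≥0) (y : Fin n → ℝ) :
    ENNReal.ofReal (arDensity h v y) = ∏ t, gaussianPDF 0 v (residual h y t) :=
  ENNReal.ofReal_prod_of_nonneg fun _ _ => gaussianPDFReal_nonneg _ _ _

/-- The residual map preserves volume and `Φ` undoes it, so the change of variables has no Jacobian.
-/
lemma map_eq_arLaw (hh : ∀ t, Measurable (h t)) {v : ℝ≥0} (hv : v ≠ 0)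
    {Φ : (Fin n → ℝ) → Fin n → ℝ} (hΦ : Measurable Φ) (hinv : ∀ y, Φ (residual h y) = y) :
    (Measure.pi fun _ : Fin n => gaussianReal 0 v).map Φ = arLaw h v := by
  have hmp := measurePreserving_residual h hh
  have hm : Measurable fun y : Fin n → ℝ => ∏ t, gaussianPDF 0 v (y t) :=
    Finset.measurable_prod _ fun t _ => (measurable_gaussianPDF 0 v).comp (measurable_pi_apply t)
  ext s hs
  rw [Measure.map_apply hΦ hs, pi_gaussianReal_eq_withDensity n hv,
    withDensity_apply _ (hΦ hs), arLaw, withDensity_apply _ hs,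
    ← hmp.setLIntegral_comp_preimage (hΦ hs) hm]
  simp_rw [ofReal_arDensity]
  congr 2
  ext y
  simp [hinv]

lemma residual_leftInverse_unique {Φ : (Fin n → ℝ) → Fin n → ℝ}
    (hΦ : ∀ z t, Φ z t = (h t fun s => Φ z ⟨s, s.2.trans t.2⟩) + z t) (y : Fin n → ℝ) :
    Φ (residual h y) = y := by
  have key : ∀ (j : ℕ) (hj : j < n), Φ (residual h y) ⟨j, hj⟩ = y ⟨j, hj⟩ := by
    intro j
    induction j using Nat.strong_induction_on with
    | _ j ih =>
      intro hj
      rw [hΦ]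
      have : (fun s : Fin j => Φ (residual h y) ⟨s, s.2.trans hj⟩) =
          fun s : Fin j => y ⟨s, s.2.trans hj⟩ := funext fun s => ih s s.2 _
      simp only [residual] at this ⊢
      rw [this]; ring
  ext t
  exact key t t.2

/-- The process with given residuals. -/
def arProcess (h : (t : Fin n) → (Fin (t : ℕ) → ℝ) → ℝ) (z : Fin n → ℝ) (t : Fin n) : ℝ :=
  (h t fun s : Fin (t : ℕ) => arProcess h z ⟨s, s.2.trans t.2⟩) + z t
termination_by (t : ℕ)
decreasing_by exact s.2

lemma arProcess_eq (z : Fin n → ℝ) (t : Fin n) :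
    arProcess h z t = (h t fun s : Fin (t : ℕ) => arProcess h z ⟨s, s.2.trans t.2⟩) + z t := by
  rw [arProcess]

lemma measurable_arProcess (hh : ∀ t, Measurable (h t)) : Measurable (arProcess h) := by
  have key : ∀ (j : ℕ) (hj : j < n), Measurable fun z => arProcess h z ⟨j, hj⟩ := by
    intro j
    induction j using Nat.strong_induction_on with
    | _ j ih =>
      intro hj
      simp_rw [fun z => arProcess_eq (h := h) z ⟨j, hj⟩]
      exact ((hh ⟨j, hj⟩).comp (measurable_pi_lambda _ fun s => ih s s.2 _)).add
        (measurable_pi_apply _)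
  exact measurable_pi_lambda _ fun t => key t t.2

lemma arProcess_residual (y : Fin n → ℝ) : arProcess h (residual h y) = y :=
  residual_leftInverse_unique (fun z t => arProcess_eq z t) y

lemma residual_arProcess (z : Fin n → ℝ) : residual h (arProcess h z) = z := by
  ext t
  rw [residual, arProcess_eq]; ring

lemma isProbabilityMeasure_arLaw (hh : ∀ t, Measurable (h t)) {v : ℝ≥0} (hv : v ≠ 0) :
    IsProbabilityMeasure (arLaw h v) := by
  rw [← map_eq_arLaw hh hv (measurable_arProcess hh) arProcess_residual]
  exact Measure.isProbabilityMeasure_map (measurable_arProcess hh).aemeasurable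

lemma arLaw_eq_withDensity (hh : ∀ t, Measurable (h t)) (hk : ∀ t, Measurable (k t)) {u v : ℝ≥0}
    (hu : u ≠ 0) :
    arLaw k v = (arLaw h u).withDensity fun y =>
      ENNReal.ofReal (arDensity k v y / arDensity h u y) := by
  have hm : Measurable fun y => arDensity k v y / arDensity h u y :=
    (measurable_arDensity hk v).div (measurable_arDensity hh u)
  rw [arLaw, arLaw, ← withDensity_mul _ (measurable_arDensity hh u).ennreal_ofReal
    hm.ennreal_ofReal]
  congr 1
  ext y
  rw [Pi.mul_apply, ← ENNReal.ofReal_mul (arDensity_pos hu y).le,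
    mul_div_cancel₀ _ (arDensity_pos hu y).ne']

end

/-- A variational lower bound on the relative entropy: if `Q` has density `r > 0` with respect to
`μ`, then `log L · μ(D) - L · Q(D) ≤ -∫ log r dμ` for every event `D`. -/
lemma log_mul_measureReal_sub_le {α : Type*} [MeasurableSpace α] {μ : Measure α}
    [IsProbabilityMeasure μ] {r : α → ℝ} (hr : Measurable r) (hpos : ∀ x, 0 < r x)
    (hlog : Integrable (fun x => Real.log (r x)) μ)
    {Q : Measure α} (hQ : Q = μ.withDensity fun x => ENNReal.ofReal (r x))
    [IsProbabilityMeasure Q] {D : Set α} (hD : MeasurableSet D) {L : ℝ} (hL : 1 ≤ L) :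
    Real.log L * μ.real D - L * Q.real D ≤ -∫ x, Real.log (r x) ∂μ := by
  have hL0 : 0 < L := by linarith
  have hInt : Integrable r μ := by
    refine ⟨hr.aestronglyMeasurable, ?_⟩
    rw [hasFiniteIntegral_iff_ofReal (ae_of_all _ fun x => (hpos x).le)]
    have : ∫⁻ x, ENNReal.ofReal (r x) ∂μ = Q Set.univ := by
      rw [hQ, withDensity_apply _ MeasurableSet.univ, Measure.restrict_univ]
    rw [this]; exact measure_lt_top _ _
  have hQD : ∀ s, MeasurableSet s → ∫ x in s, r x ∂μ = Q.real s := by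
    intro s hs
    rw [integral_eq_lintegral_of_nonneg_ae (ae_of_all _ fun x => (hpos x).le)
      hr.aestronglyMeasurable, measureReal_def, hQ, withDensity_apply _ hs]
  have hone : ∫ x, r x ∂μ = 1 := by
    have := hQD Set.univ MeasurableSet.univ
    simpa using this
  -- This is `log u ≤ u - 1` at `u = r x` off `D` and at `u = L * r x` on `D`; integrating it gives
  -- the bound with the sharper constant `L - 1`.
  have hpt : ∀ x, Real.log (r x) + D.indicator (fun _ => Real.log L) x ≤
      r x + (L - 1) * D.indicator r x - 1 := by
    intro x
    by_cases hx : x ∈ D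
    · simp only [Set.indicator_of_mem hx]
      rw [← Real.log_mul (hpos x).ne' hL0.ne']
      have := Real.log_le_sub_one_of_pos (mul_pos (hpos x) hL0)
      linarith
    · simp only [Set.indicator_of_notMem hx]
      have := Real.log_le_sub_one_of_pos (hpos x)
      linarith
  have hDi : Integrable (D.indicator fun _ => Real.log L) μ :=
    (integrable_const _).indicator hD
  have hri : Integrable (D.indicator r) μ := hInt.indicator hD
  have hs : Integrable (fun x => r x + (L - 1) * D.indicator r x) μ :=
    hInt.add (hri.const_mul (L - 1))
  have := integral_mono (hlog.add hDi) (hs.sub (integrable_const 1)) hpt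
  simp only [Pi.add_apply, Pi.sub_apply] at this
  rw [integral_add hlog hDi, integral_sub hs (integrable_const 1),
    integral_add hInt (hri.const_mul _), integral_const_mul, integral_indicator hD,
    integral_indicator hD, hone, hQD D hD] at this
  simp at this
  have h0 : 0 ≤ Q.real D := measureReal_nonneg
  nlinarith

section
variable {n : ℕ} {h k : (t : Fin n) → (Fin (t : ℕ) → ℝ) → ℝ}

lemma arProcess_congr {z z' : Fin n → ℝ} (t : Fin n) (hz : ∀ s ≤ t, z s = z' s) :
    arProcess h z t = arProcess h z' t := by
  obtain ⟨j, hj⟩ := t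
  induction j using Nat.strong_induction_on with
  | _ j ih =>
    rw [arProcess_eq, arProcess_eq, hz _ le_rfl]
    congr 2
    funext s
    exact ih s s.2 _ fun r hr => hz r (hr.trans (Fin.mk_le_mk.2 s.2.le))

/-- The one-step prediction along the process driven by `z`. -/
def arPredict (h g : (t : Fin n) → (Fin (t : ℕ) → ℝ) → ℝ) (t : Fin n) (z : Fin n → ℝ) : ℝ :=
  g t fun s => arProcess h z ⟨s, s.2.trans t.2⟩

lemma measurable_arPredict (hh : ∀ t, Measurable (h t)) (hk : ∀ t, Measurable (k t)) (t : Fin n) :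
    Measurable (arPredict h k t) :=
  (hk t).comp (measurable_pi_lambda _ fun _ => (measurable_pi_apply _).comp
    (measurable_arProcess hh))

lemma memLp_eval (u : ℝ≥0) (t : Fin n) :
    MemLp (fun z : Fin n → ℝ => z t) 2 (Measure.pi fun _ : Fin n => gaussianReal 0 u) :=
  (memLp_id_gaussianReal' 2 (by simp)).comp_measurePreserving
    (measurePreserving_eval (fun _ : Fin n => gaussianReal 0 u) t)

lemma integral_eval_sq (u : ℝ≥0) (t : Fin n) :
    ∫ z : Fin n → ℝ, z t ^ 2 ∂(Measure.pi fun _ : Fin n => gaussianReal 0 u) = u := by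
  have hmp := measurePreserving_eval (fun _ : Fin n => gaussianReal 0 u) t
  have h1 : ∫ z : Fin n → ℝ, z t ^ 2 ∂(Measure.pi fun _ : Fin n => gaussianReal 0 u) =
      ∫ x, x ^ 2 ∂(gaussianReal 0 u) := by
    have := integral_map (μ := Measure.pi fun _ : Fin n => gaussianReal 0 u)
      hmp.measurable.aemeasurable (f := fun x : ℝ => x ^ 2) (by fun_prop)
    rw [hmp.map_eq] at this
    exact this.symm
  rw [h1]
  have h2 := variance_fun_id_gaussianReal (μ := 0) (v := u)
  rw [variance_eq_integral (by fun_prop)] at h2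
  simpa using h2

/-- A square-integrable function of the past is uncorrelated with the present noise. -/
lemma integral_arPredict_mul_eval (u : ℝ≥0) (t : Fin n) :
    ∫ z, arPredict h k t z * z t ∂(Measure.pi fun _ : Fin n => gaussianReal 0 u) = 0 := by
  -- Flipping the sign of the present noise preserves the law and leaves the prediction unchanged,
  -- so the integral equals its own negative.
  let T : (Fin n → ℝ) → Fin n → ℝ := fun z i => if i = t then -z i else z i
  have hT : MeasurePreserving T (Measure.pi fun _ : Fin n => gaussianReal 0 u)
      (Measure.pi fun _ : Fin n => gaussianReal 0 u) := by
    refine measurePreserving_pi (f := fun i x => if i = t then -x else x) _ _ fun i => ?_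
    by_cases hi : i = t
    · simp only [hi, if_true]
      exact ⟨measurable_neg, by simpa using gaussianReal_map_neg (μ := 0) (v := u)⟩
    · simp only [hi, if_false]
      exact MeasurePreserving.id _
  have hTe : MeasurableEmbedding T := by
    refine MeasurableEmbedding.of_measurable_inverse (g := T) hT.measurable ?_ hT.measurable ?_
    · rw [Function.Surjective.range_eq]
      · exact MeasurableSet.univ
      · intro z
        refine ⟨T z, ?_⟩
        ext i; by_cases hi : i = t <;> simp [T, hi]
    · intro z; ext i; by_cases hi : i = t <;> simp [T, hi]
  have h1 := hT.integral_comp hTe (fun z => arPredict h k t z * z t)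
  have h2 : ∀ z, arPredict h k t (T z) * T z t = -(arPredict h k t z * z t) := by
    intro z
    have : arPredict h k t (T z) = arPredict h k t z := by
      unfold arPredict
      congr 1
      funext s
      refine arProcess_congr _ fun r hr => ?_
      have : r ≠ t := ((Fin.le_def.1 hr).trans_lt s.2 |> Fin.lt_def.2).ne
      simp [T, this]
    rw [this]; simp [T]
  simp_rw [h2] at h1
  rw [integral_neg] at h1
  linarith

lemma log_gaussianPDFReal {v : ℝ≥0} (hv : v ≠ 0) (x : ℝ) :
    Real.log (gaussianPDFReal 0 v x) =
      -(1 / 2 * Real.log (2 * Real.pi * v)) - x ^ 2 / (2 * v) := by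
  have hv' : (0 : ℝ) < v := by positivity
  have hs : 0 < 2 * Real.pi * (v : ℝ) := by positivity
  rw [gaussianPDFReal, Real.log_mul (by positivity) (by positivity), Real.log_exp, Real.log_inv,
    Real.log_sqrt hs.le]
  ring

/-- The right side is the relative entropy of the two laws. Along the process generated by `h`, the
residual for `k` is the prediction gap plus the fresh noise; the cross term has mean zero, so only
the two second moments remain. -/
lemma log_mul_arLaw_sub_le (hh : ∀ t, Measurable (h t)) (hk : ∀ t, Measurable (k t)) {u v : ℝ≥0}
    (hu : u ≠ 0) (hv : v ≠ 0)
    (hd : ∀ t, MemLp (fun z => arPredict h h t z - arPredict h k t z) 2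
      (Measure.pi fun _ : Fin n => gaussianReal 0 u))
    {D : Set (Fin n → ℝ)} (hD : MeasurableSet D) {L : ℝ} (hL : 1 ≤ L) :
    Real.log L * (arLaw h u).real D - L * (arLaw k v).real D ≤
      ∑ t, (1 / 2 * Real.log (v / u) - 1 / 2 + (u + ∫ z, (arPredict h h t z - arPredict h k t z) ^ 2
        ∂(Measure.pi fun _ : Fin n => gaussianReal 0 u)) / (2 * v)) := by
  set μ := Measure.pi fun _ : Fin n => gaussianReal 0 u with hμ
  have hu' : (0 : ℝ) < u := by positivity
  have hv' : (0 : ℝ) < v := by positivity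
  have := isProbabilityMeasure_arLaw hh hu
  have := isProbabilityMeasure_arLaw hk hv
  have hΦ := measurable_arProcess hh
  have hmap : μ.map (arProcess h) = arLaw h u := map_eq_arLaw hh hu hΦ arProcess_residual
  set r : (Fin n → ℝ) → ℝ := fun y => arDensity k v y / arDensity h u y with hr
  have hrm : Measurable r := (measurable_arDensity hk v).div (measurable_arDensity hh u)
  have hlm : Measurable fun y => Real.log (r y) := Real.measurable_log.comp hrm
  have hres : ∀ z t, residual k (arProcess h z) t =
      (arPredict h h t z - arPredict h k t z) + z t := by
    intro z t
    rw [residual, arProcess_eq]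
    unfold arPredict
    ring
  have hlogr : ∀ z, Real.log (r (arProcess h z)) = ∑ t, (-(1 / 2 * Real.log (v / u)) -
      ((arPredict h h t z - arPredict h k t z) + z t) ^ 2 / (2 * v) + z t ^ 2 / (2 * u)) := by
    intro z
    rw [hr]
    simp only
    rw [Real.log_div (arDensity_pos hv _).ne' (arDensity_pos hu _).ne', arDensity, arDensity,
      Real.log_prod fun t _ => (gaussianPDFReal_pos 0 v _ hv).ne',
      Real.log_prod fun t _ => (gaussianPDFReal_pos 0 u _ hu).ne', ← Finset.sum_sub_distrib]
    refine Finset.sum_congr rfl fun t _ => ?_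
    rw [log_gaussianPDFReal hv, log_gaussianPDFReal hu, hres, residual_arProcess,
      Real.log_div hv'.ne' hu'.ne', Real.log_mul (by positivity) hv'.ne',
      Real.log_mul (by positivity) hu'.ne']
    ring
  have hi1 : ∀ t, Integrable (fun z => (arPredict h h t z - arPredict h k t z) ^ 2) μ :=
    fun t => (hd t).integrable_sq
  have hi2 : ∀ t, Integrable (fun z : Fin n → ℝ => z t ^ 2) μ := fun t =>
    (memLp_eval u t).integrable_sq
  have hi3 : ∀ t, Integrable (fun z => (arPredict h h t z - arPredict h k t z) * z t) μ :=
    fun t => (hd t).integrable_mul (memLp_eval u t)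
  -- The gap `h - k` is itself a function of the past, hence uncorrelated with the present noise.
  have hz3 : ∀ t, ∫ z, (arPredict h h t z - arPredict h k t z) * z t ∂μ = 0 := fun t =>
    integral_arPredict_mul_eval (h := h) (k := fun t y => h t y - k t y) u t
  have hexp : ∀ t z, (-(1 / 2 * Real.log (v / u)) -
      ((arPredict h h t z - arPredict h k t z) + z t) ^ 2 / (2 * v) + z t ^ 2 / (2 * u)) =
      -(1 / 2 * Real.log (v / u)) +
        (-(1 / (2 * v)) * (arPredict h h t z - arPredict h k t z) ^ 2 +
        (-(1 / v) * ((arPredict h h t z - arPredict h k t z) * z t) +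
        (1 / (2 * u) - 1 / (2 * v)) * z t ^ 2)) := by
    intro t z
    field_simp
    ring
  have hit₂ : ∀ t, Integrable (fun z =>
        -(1 / v) * ((arPredict h h t z - arPredict h k t z) * z t) +
        (1 / (2 * u) - 1 / (2 * v)) * z t ^ 2) μ := fun t =>
    ((hi3 t).const_mul _).add ((hi2 t).const_mul _)
  have hit₁ : ∀ t, Integrable (fun z =>
        -(1 / (2 * v)) * (arPredict h h t z - arPredict h k t z) ^ 2 +
        (-(1 / v) * ((arPredict h h t z - arPredict h k t z) * z t) +
        (1 / (2 * u) - 1 / (2 * v)) * z t ^ 2)) μ := fun t =>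
    ((hi1 t).const_mul _).add (hit₂ t)
  have hit : ∀ t, Integrable (fun z => -(1 / 2 * Real.log (v / u)) +
        (-(1 / (2 * v)) * (arPredict h h t z - arPredict h k t z) ^ 2 +
        (-(1 / v) * ((arPredict h h t z - arPredict h k t z) * z t) +
        (1 / (2 * u) - 1 / (2 * v)) * z t ^ 2))) μ := fun t =>
    (integrable_const _).add (hit₁ t)
  have hInt : Integrable (fun z => Real.log (r (arProcess h z))) μ := by
    simp_rw [hlogr, hexp]
    exact integrable_finsetSum _ fun t _ => hit t
  have hlog : Integrable (fun y => Real.log (r y)) (arLaw h u) := by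
    rw [← hmap, integrable_map_measure hlm.aestronglyMeasurable
      hΦ.aemeasurable]
    exact hInt
  have key := log_mul_measureReal_sub_le hrm
    (fun y => div_pos (arDensity_pos hv y) (arDensity_pos hu y)) hlog
    (arLaw_eq_withDensity hh hk hu) hD hL
  refine key.trans (le_of_eq ?_)
  rw [← hmap, integral_map hΦ.aemeasurable hlm.aestronglyMeasurable]
  simp_rw [hlogr, hexp]
  rw [integral_finsetSum _ fun t _ => hit t, ← Finset.sum_neg_distrib]
  refine Finset.sum_congr rfl fun t _ => ?_
  rw [integral_add (integrable_const _) (hit₁ t), integral_add ((hi1 t).const_mul _) (hit₂ t),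
    integral_add ((hi3 t).const_mul _) ((hi2 t).const_mul _),
    integral_const_mul, integral_const_mul, integral_const_mul, hz3, hμ, integral_eval_sq]
  simp
  field_simp
  ring

end

/-! ### Codes for perfect feedback -/

lemma multivariateGaussian_zero_zero :
    multivariateGaussian (0 : EuclideanSpace ℝ (Fin 2)) 0 = Measure.dirac 0 := by
  simp [multivariateGaussian]

lemma noiseLaw_zero (n : ℕ) (N : ℝ) :
    noiseLaw n N 0 = (Measure.pi fun _ : Fin n => gaussianReal 0 N.toNNReal).map
      fun z => (z, 0) := by
  have : (Measure.pi fun _ : Fin n => (Measure.dirac (0 : EuclideanSpace ℝ (Fin 2)))) =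
      Measure.dirac 0 := by
    refine Measure.pi_eq fun s hs => ?_
    by_cases h : (0 : Fin n → EuclideanSpace ℝ (Fin 2)) ∈ Set.univ.pi s
    · rw [Measure.dirac_apply_of_mem h]
      refine (Finset.prod_eq_one fun i _ => ?_).symm
      exact Measure.dirac_apply_of_mem (h i trivial)
    · rw [Measure.dirac_apply' _ (MeasurableSet.univ_pi hs), Set.indicator_of_notMem h]
      simp only [Set.mem_univ_pi, not_forall] at h
      obtain ⟨i, hi⟩ := h
      refine (Finset.prod_eq_zero (Finset.mem_univ i) ?_).symm
      rw [Measure.dirac_apply' _ (hs i)]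
      exact Set.indicator_of_notMem hi _
  rw [noiseLaw, multivariateGaussian_zero_zero, this, Measure.prod_dirac]

namespace FeedbackCode

variable {n : ℕ} {M : Fin 2 → ℕ} (c : FeedbackCode n M)

/-- The predictor of the channel output from its past that gives user `ν` weight `γ ν`. -/
def predictor (γ : Fin 2 → ℝ) (m : (ν : Fin 2) → Fin (M ν)) (t : Fin n) (y : Fin (t : ℕ) → ℝ) :
    ℝ := ∑ ν, γ ν * c.enc ν t (m ν) y

lemma measurable_predictor (γ : Fin 2 → ℝ) (m : (ν : Fin 2) → Fin (M ν)) (t : Fin n) :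
    Measurable (c.predictor γ m t) :=
  Finset.measurable_sum _ fun ν _ => (c.measurable_enc ν t (m ν)).const_mul _

/-- With unit weights the predictor is the sum of the two inputs, so the residual of the output is
the channel noise. -/
lemma output_zero (m : (ν : Fin 2) → Fin (M ν)) (z : Fin n → ℝ) :
    c.output m z 0 = arProcess (c.predictor 1 m) z := by
  have : residual (c.predictor 1 m) (c.output m z 0) = z := by
    ext t
    rw [residual, output]
    simp [predictor]
  rw [← this, arProcess_residual, this]

lemma input_zero (m : (ν : Fin 2) → Fin (M ν)) (z : Fin n → ℝ) (ν : Fin 2) (t : Fin n) :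
    c.input m z 0 ν t = arPredict (c.predictor 1 m) (fun t y => c.enc ν t (m ν) y) t z := by
  rw [input, output_zero]
  simp [arPredict]

lemma measurableSet_dec (m : (ν : Fin 2) → Fin (M ν)) : MeasurableSet {y | c.dec y = m} :=
  c.measurable_dec (measurableSet_singleton m)

end FeedbackCode

namespace FeedbackCode

variable {n : ℕ} {M : Fin 2 → ℕ} (c : FeedbackCode n M)

lemma card_messages : (Fintype.card ((ν : Fin 2) → Fin (M ν)) : ℝ) = (M 0 : ℝ) * M 1 := by
  simp [Fin.prod_univ_two]

lemma messages_pos (c : FeedbackCode n M) : (0 : ℝ) < (M 0 : ℝ) * M 1 := by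
  have h0 := c.card_pos 0
  have h1 := c.card_pos 1
  positivity

lemma measureReal_error (N : ℝ) (hN : 0 < N) (m : (ν : Fin 2) → Fin (M ν)) :
    (noiseLaw n N 0).real {ω | c.dec (c.output m ω.1 ω.2) ≠ m} =
      1 - (arLaw (c.predictor 1 m) N.toNNReal).real {y | c.dec y = m} := by
  have hv : N.toNNReal ≠ 0 := by simpa using hN
  have hp := c.measurable_predictor 1 m
  have := isProbabilityMeasure_arLaw hp hv
  have hD := c.measurableSet_dec m
  rw [← probReal_compl_eq_one_sub hD,
    ← map_eq_arLaw hp hv (measurable_arProcess hp) arProcess_residual, measureReal_def,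
    measureReal_def, Measure.map_apply (measurable_arProcess hp) hD.compl, noiseLaw_zero]
  have he : MeasurableEmbedding fun z : Fin n → ℝ =>
      (z, (0 : Fin n → EuclideanSpace ℝ (Fin 2))) := measurableEmbedding_prod_mk_right 0
  rw [he.map_apply]
  congr 2
  ext z
  simp [output_zero]

lemma one_sub_errorProb (N : ℝ) (hN : 0 < N) :
    1 - c.errorProb N 0 = (1 / ((M 0 : ℝ) * M 1)) * ∑ m : (ν : Fin 2) → Fin (M ν),
      (arLaw (c.predictor 1 m) N.toNNReal).real {y | c.dec y = m} := by
  have h := c.messages_pos.ne'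
  rw [errorProb]
  simp_rw [c.measureReal_error N hN]
  rw [Finset.sum_sub_distrib, Finset.sum_const, Finset.card_univ, nsmul_eq_mul, card_messages,
    mul_sub, mul_one, one_div_mul_cancel h]
  ring

/-- The law of the noise `Z` of the forward channel. -/
abbrev forwardLaw (n : ℕ) (N : ℝ) : Measure (Fin n → ℝ) :=
  Measure.pi fun _ : Fin n => gaussianReal 0 N.toNNReal

/-- The expectation of a function of the messages, the noise and the time, averaged over time. -/
def avg (n : ℕ) (M : Fin 2 → ℕ) (N : ℝ)
    (f : ((ν : Fin 2) → Fin (M ν)) → Fin n → (Fin n → ℝ) → ℝ) : ℝ :=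
  (1 / (n : ℝ)) * ∑ t, (1 / ((M 0 : ℝ) * M 1)) * ∑ m, ∫ z, f m t z ∂(forwardLaw n N)

/-- This plays the role of Fano's inequality. The entropy bound is averaged over the messages:
`hsum` makes the guessing term at most one, and `hSavg` bounds the mean squared residual by `S`, so
that the quadratic term is absorbed by `-1/2` and `n/2 · log (S / N)` remains. -/
lemma rate_le (hn : 0 < n) {N : ℝ} (hN : 0 < N)
    (hL2 : ∀ m ν t, MemLp (fun z => c.input m z 0 ν t) 2 (forwardLaw n N))
    (γ : Fin 2 → ℝ) {S L : ℝ} (hS : 0 < S) (hL : 1 ≤ L)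
    (hsum : ∑ m : (ν : Fin 2) → Fin (M ν),
      L * (arLaw (c.predictor γ m) S.toNNReal).real {y | c.dec y = m} ≤ (M 0 : ℝ) * M 1)
    (hSavg : N + avg n M N (fun m t z => (∑ ν, (1 - γ ν) * c.input m z 0 ν t) ^ 2) ≤ S) :
    (1 - c.errorProb N 0) * Real.log L - 1 ≤ n * (1 / 2 * Real.log (S / N)) := by
  have hM := c.messages_pos
  have hn' : (0 : ℝ) < n := by exact_mod_cast hn
  have hu : N.toNNReal ≠ 0 := by simpa using hN
  have hv : S.toNNReal ≠ 0 := by simpa using hS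
  have hdiff : ∀ m t z, arPredict (c.predictor 1 m) (c.predictor 1 m) t z -
      arPredict (c.predictor 1 m) (c.predictor γ m) t z =
        ∑ ν, (1 - γ ν) * c.input m z 0 ν t := by
    intro m t z
    simp_rw [input_zero]
    simp [arPredict, predictor]
    ring
  have hmem : ∀ m t, MemLp (fun z => ∑ ν, (1 - γ ν) * c.input m z 0 ν t) 2 (forwardLaw n N) :=
    fun m t => memLp_finsetSum _ fun ν _ => (hL2 m ν t).const_mul _
  have key : ∀ m, Real.log L * (arLaw (c.predictor 1 m) N.toNNReal).real {y | c.dec y = m} -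
      L * (arLaw (c.predictor γ m) S.toNNReal).real {y | c.dec y = m} ≤
      ∑ t, (1 / 2 * Real.log (S / N) - 1 / 2 +
        (N + ∫ z, (∑ ν, (1 - γ ν) * c.input m z 0 ν t) ^ 2 ∂(forwardLaw n N)) / (2 * S)) := by
    intro m
    have := log_mul_arLaw_sub_le (c.measurable_predictor 1 m) (c.measurable_predictor γ m) hu hv
      (by simp_rw [hdiff]; exact hmem m) (c.measurableSet_dec m) hL
    simp_rw [hdiff] at this
    simpa [Real.coe_toNNReal _ hN.le, Real.coe_toNNReal _ hS.le] using this
  have hsum2 := Finset.sum_le_sum fun m (_ : m ∈ Finset.univ) => key m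
  rw [Finset.sum_sub_distrib, ← Finset.mul_sum, Finset.sum_comm] at hsum2
  simp_rw [Finset.sum_add_distrib, Finset.sum_const, Finset.card_univ, nsmul_eq_mul,
    card_messages, ← Finset.sum_div, Finset.sum_add_distrib, Finset.sum_const, Finset.card_univ,
    nsmul_eq_mul, card_messages, Fintype.card_fin] at hsum2
  have havg : ∑ t, ∑ m, ∫ z, (∑ ν, (1 - γ ν) * c.input m z 0 ν t) ^ 2 ∂(forwardLaw n N) =
      n * ((M 0 : ℝ) * M 1) *
        avg n M N (fun m t z => (∑ ν, (1 - γ ν) * c.input m z 0 ν t) ^ 2) := by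
    rw [avg, ← Finset.mul_sum]
    generalize (M 0 : ℝ) * M 1 = K at hM
    field_simp
  rw [havg] at hsum2
  rw [c.one_sub_errorProb N hN]
  set A := avg n M N (fun m t z => (∑ ν, (1 - γ ν) * c.input m z 0 ν t) ^ 2)
  set T := ∑ m : (ν : Fin 2) → Fin (M ν),
    (arLaw (c.predictor 1 m) N.toNNReal).real {y | c.dec y = m}
  have hA : (N + A) / (2 * S) ≤ 1 / 2 := by
    rw [div_le_iff₀ (by positivity)]; linarith
  have h1 : Real.log L * T - (M 0 : ℝ) * M 1 ≤
      ((M 0 : ℝ) * M 1) * (n * (1 / 2 * Real.log (S / N))) := by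
    have h2 : n * ((M 0 : ℝ) * M 1) * ((N + A) / (2 * S)) ≤ n * ((M 0 : ℝ) * M 1) * (1 / 2) := by
      gcongr
    have e : n * ((M 0 : ℝ) * M 1 * (1 / 2 * Real.log (S / N) - 1 / 2)) +
        (n * ((M 0 : ℝ) * M 1 * N) + n * ((M 0 : ℝ) * M 1) * A) / (2 * S) =
        ((M 0 : ℝ) * M 1) * (n * (1 / 2 * Real.log (S / N))) +
        (n * ((M 0 : ℝ) * M 1) * ((N + A) / (2 * S)) - n * ((M 0 : ℝ) * M 1) * (1 / 2)) := by
      ring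
    linarith
  rw [← mul_le_mul_iff_of_pos_left hM]
  refine le_trans (le_of_eq ?_) h1
  generalize (M 0 : ℝ) * M 1 = K at hM
  field_simp

lemma sum_measureReal_dec_le_one (Q : Measure (Fin n → ℝ)) [IsProbabilityMeasure Q]
    (s : Finset ((ν : Fin 2) → Fin (M ν))) : ∑ m ∈ s, Q.real {y | c.dec y = m} ≤ 1 := by
  have := sum_measureReal_preimage_singleton (μ := Q) s (f := c.dec)
    fun m _ => c.measurableSet_dec m
  exact this.le.trans measureReal_le_one

/-- With zero weights the reference law is the same for all messages, and the decoding sets are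
disjoint. -/
lemma sum_joint_le {S : ℝ} (hS : 0 < S) :
    ∑ m : (ν : Fin 2) → Fin (M ν), ((M 0 : ℝ) * M 1) *
      (arLaw (c.predictor 0 m) S.toNNReal).real {y | c.dec y = m} ≤ (M 0 : ℝ) * M 1 := by
  have hv : S.toNNReal ≠ 0 := by simpa using hS
  have hp : ∀ m, c.predictor 0 m = fun _ _ => 0 := fun m => by
    funext t y; simp [predictor]
  simp_rw [hp]
  have := isProbabilityMeasure_arLaw (n := n) (h := fun _ _ => 0) (fun t => measurable_const) hv
  rw [← Finset.mul_sum]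
  exact mul_le_of_le_one_right c.messages_pos.le (c.sum_measureReal_dec_le_one _ _)

/-- The reference law depends only on the other user's message. For each value of that message the
decoding sets are disjoint, so the success probabilities sum to at most one. -/
lemma sum_single_le {S : ℝ} (hS : 0 < S) {γ : Fin 2 → ℝ} {ν ν' : Fin 2} (hν : ν ≠ ν')
    (hγ : γ ν = 0) :
    ∑ m : (ν : Fin 2) → Fin (M ν), (M ν : ℝ) *
      (arLaw (c.predictor γ m) S.toNNReal).real {y | c.dec y = m} ≤ (M 0 : ℝ) * M 1 := by
  have hv : S.toNNReal ≠ 0 := by simpa using hS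
  have hMM : (M 0 : ℝ) * M 1 = M ν * M ν' := by
    fin_cases ν <;> fin_cases ν' <;> first | exact absurd rfl hν | simp [mul_comm]
  have hp : ∀ m, c.predictor γ m = fun t y => γ ν' * c.enc ν' t (m ν') y := fun m => by
    funext t y
    fin_cases ν <;> fin_cases ν' <;> first | exact absurd rfl hν | simp_all [predictor]
  rw [hMM, ← Finset.mul_sum]
  refine mul_le_mul_of_nonneg_left ?_ (by positivity)
  rw [← Finset.sum_fiberwise Finset.univ fun m : (ν : Fin 2) → Fin (M ν) => m ν']
  have : ∀ j : Fin (M ν'), ∑ m : (ν : Fin 2) → Fin (M ν) with m ν' = j,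
      (arLaw (c.predictor γ m) S.toNNReal).real {y | c.dec y = m} ≤ 1 := by
    intro j
    have := isProbabilityMeasure_arLaw (n := n) (h := fun t y => γ ν' * c.enc ν' t j y)
      (fun t => (c.measurable_enc ν' t j).const_mul _) hv
    refine le_trans (le_of_eq ?_) (c.sum_measureReal_dec_le_one
      (arLaw (fun t y => γ ν' * c.enc ν' t j y) S.toNNReal)
      {m : (ν : Fin 2) → Fin (M ν) | m ν' = j})
    refine Finset.sum_congr rfl fun m hm => ?_
    rw [hp, (Finset.mem_filter.1 hm).2]
  refine (Finset.sum_le_sum fun j _ => this j).trans ?_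
  simp

lemma avg_nonneg {N : ℝ} {f : ((ν : Fin 2) → Fin (M ν)) → Fin n → (Fin n → ℝ) → ℝ}
    (hf : ∀ m t z, 0 ≤ f m t z) : 0 ≤ avg n M N f := by
  have : ∀ t m, 0 ≤ ∫ z, f m t z ∂(forwardLaw n N) := fun t m => integral_nonneg (hf m t)
  unfold avg
  exact mul_nonneg (by positivity) (Finset.sum_nonneg fun t _ => mul_nonneg (by positivity)
    (Finset.sum_nonneg fun m _ => this t m))

lemma avg_sq_combination {N : ℝ}
    (hL2 : ∀ m ν t, MemLp (fun z => c.input m z 0 ν t) 2 (forwardLaw n N)) (β : Fin 2 → ℝ) :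
    avg n M N (fun m t z => (∑ ν, β ν * c.input m z 0 ν t) ^ 2) =
      β 0 ^ 2 * avg n M N (fun m t z => c.input m z 0 0 t ^ 2) +
      β 1 ^ 2 * avg n M N (fun m t z => c.input m z 0 1 t ^ 2) +
      2 * β 0 * β 1 * avg n M N (fun m t z => c.input m z 0 0 t * c.input m z 0 1 t) := by
  have hInt : ∀ m t, ∫ z, (∑ ν, β ν * c.input m z 0 ν t) ^ 2 ∂(forwardLaw n N) =
      β 0 ^ 2 * ∫ z, c.input m z 0 0 t ^ 2 ∂(forwardLaw n N) +
      β 1 ^ 2 * ∫ z, c.input m z 0 1 t ^ 2 ∂(forwardLaw n N) +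
      2 * β 0 * β 1 * ∫ z, c.input m z 0 0 t * c.input m z 0 1 t ∂(forwardLaw n N) := by
    intro m t
    have h0 := (hL2 m 0 t).integrable_sq
    have h1 := (hL2 m 1 t).integrable_sq
    have h2 : Integrable (fun z => c.input m z 0 0 t * c.input m z 0 1 t) (forwardLaw n N) :=
      (hL2 m 0 t).integrable_mul (hL2 m 1 t)
    have h01 : Integrable (fun z => β 0 ^ 2 * c.input m z 0 0 t ^ 2 +
        β 1 ^ 2 * c.input m z 0 1 t ^ 2) (forwardLaw n N) := (h0.const_mul _).add (h1.const_mul _)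
    rw [← integral_const_mul, ← integral_const_mul, ← integral_const_mul,
      ← integral_add (h0.const_mul _) (h1.const_mul _), ← integral_add h01 (h2.const_mul _)]
    refine integral_congr_ae (ae_of_all _ fun z => ?_)
    simp only [Fin.sum_univ_two]
    ring
  unfold avg
  simp only [hInt, Finset.sum_add_distrib, ← Finset.mul_sum]
  ring

lemma PowerConstraint.memLp {c : FeedbackCode n M} {N P : ℝ} {ν : Fin 2}
    (h : c.PowerConstraint N 0 ν P) (m : (ν : Fin 2) → Fin (M ν)) (t : Fin n) :
    MemLp (fun z => c.input m z 0 ν t) 2 (forwardLaw n N) := by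
  have h1 := h.1 m t
  rw [noiseLaw_zero] at h1
  exact (memLp_map_measure_iff h1.aestronglyMeasurable
    (measurable_prodMk_right.aemeasurable)).1 h1

lemma PowerConstraint.avg_le {c : FeedbackCode n M} {N P : ℝ} {ν : Fin 2}
    (h : c.PowerConstraint N 0 ν P) :
    avg n M N (fun m t z => c.input m z 0 ν t ^ 2) ≤ P := by
  have h1 := h.2
  have he : MeasurableEmbedding fun z : Fin n → ℝ =>
      (z, (0 : Fin n → EuclideanSpace ℝ (Fin 2))) := measurableEmbedding_prod_mk_right 0
  simp_rw [noiseLaw_zero, he.integral_map] at h1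
  exact h1

end FeedbackCode

open FeedbackCode

/-! ### The outer bound on the perfect-feedback capacity region -/

/-- The pairs satisfying the three mutual-information bounds for inputs of powers `P₁, P₂` and some
correlation `ρ ∈ [0, 1]`. -/
def ozOuter (P₁ P₂ N : ℝ) : Set (ℝ × ℝ) :=
  {R | ∃ ρ ∈ Set.Icc (0 : ℝ) 1,
    R.1 ≤ 1 / 2 * Real.log (1 + P₁ * (1 - ρ ^ 2) / N) ∧
    R.2 ≤ 1 / 2 * Real.log (1 + P₂ * (1 - ρ ^ 2) / N) ∧
    R.1 + R.2 ≤ 1 / 2 * Real.log ((P₁ + P₂ + 2 * √(P₁ * P₂) * ρ + N) / N)}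

/-- Three reference laws are used, one per bound. The correlation comes from `Γ`, the cross moment
of the inputs averaged over time, messages and noise. -/
lemma FeedbackCode.mem_ozOuter {n : ℕ} {M : Fin 2 → ℕ} (c : FeedbackCode n M) (hn : 0 < n)
    {P₁ P₂ N : ℝ} (hP₁ : 0 < P₁) (hP₂ : 0 < P₂) (hN : 0 < N)
    (h₁ : c.PowerConstraint N 0 0 P₁) (h₂ : c.PowerConstraint N 0 1 P₂) :
    ((1 - c.errorProb N 0) * (1 / (n : ℝ) * Real.log (M 0)) - 1 / n,
      (1 - c.errorProb N 0) * (1 / (n : ℝ) * Real.log (M 1)) - 1 / n) ∈ ozOuter P₁ P₂ N := by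
  have hn' : (0 : ℝ) < n := by exact_mod_cast hn
  have hL2 : ∀ m ν t, MemLp (fun z => c.input m z 0 ν t) 2 (forwardLaw n N) := by
    intro m ν t
    fin_cases ν
    · exact h₁.memLp m t
    · exact h₂.memLp m t
  set Q₁ := avg n M N (fun m t z => c.input m z 0 0 t ^ 2)
  set Q₂ := avg n M N (fun m t z => c.input m z 0 1 t ^ 2)
  set Γ := avg n M N (fun m t z => c.input m z 0 0 t * c.input m z 0 1 t)
  have hQ₁ : Q₁ ≤ P₁ := h₁.avg_le
  have hQ₂ : Q₂ ≤ P₂ := h₂.avg_le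
  have hquad : ∀ β : Fin 2 → ℝ, avg n M N (fun m t z => (∑ ν, β ν * c.input m z 0 ν t) ^ 2) =
      β 0 ^ 2 * Q₁ + β 1 ^ 2 * Q₂ + 2 * β 0 * β 1 * Γ := c.avg_sq_combination hL2
  have hnn : ∀ β : Fin 2 → ℝ, 0 ≤ β 0 ^ 2 * Q₁ + β 1 ^ 2 * Q₂ + 2 * β 0 * β 1 * Γ := fun β => by
    rw [← hquad]; exact avg_nonneg fun _ _ _ => sq_nonneg _
  -- The mean square of `X₁ - (Γ / P₂) X₂`: the regression coefficient is taken with the allowed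
  -- power `P₂`, which only loosens the bound since `Q₂ ≤ P₂`.
  have hle₁ : Q₁ + (-(Γ / P₂)) ^ 2 * Q₂ + 2 * -(Γ / P₂) * Γ ≤ P₁ - Γ ^ 2 / P₂ := by
    have : (-(Γ / P₂)) ^ 2 * Q₂ ≤ (-(Γ / P₂)) ^ 2 * P₂ := by gcongr
    have e : (-(Γ / P₂)) ^ 2 * P₂ = Γ ^ 2 / P₂ := by field_simp
    have e2 : 2 * -(Γ / P₂) * Γ = -2 * (Γ ^ 2 / P₂) := by ring
    linarith
  have hle₂ : (-(Γ / P₁)) ^ 2 * Q₁ + Q₂ + 2 * -(Γ / P₁) * Γ ≤ P₂ - Γ ^ 2 / P₁ := by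
    have : (-(Γ / P₁)) ^ 2 * Q₁ ≤ (-(Γ / P₁)) ^ 2 * P₁ := by gcongr
    have e : (-(Γ / P₁)) ^ 2 * P₁ = Γ ^ 2 / P₁ := by field_simp
    have e2 : 2 * -(Γ / P₁) * Γ = -2 * (Γ ^ 2 / P₁) := by ring
    linarith
  have hnn₁ : 0 ≤ P₁ - Γ ^ 2 / P₂ := by
    have := hnn ![1, -(Γ / P₂)]
    simp at this
    rw [neg_sq] at hle₁
    linarith
  have hnn₂ : 0 ≤ P₂ - Γ ^ 2 / P₁ := by
    have := hnn ![-(Γ / P₁), 1]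
    simp at this
    rw [neg_sq] at hle₂
    linarith
  have hnn₃ : 0 ≤ P₁ + P₂ + 2 * Γ := by
    have := hnn ![1, 1]
    simp at this
    linarith
  have hs : 0 < √(P₁ * P₂) := Real.sqrt_pos.2 (mul_pos hP₁ hP₂)
  have hs2 : √(P₁ * P₂) ^ 2 = P₁ * P₂ := Real.sq_sqrt (mul_pos hP₁ hP₂).le
  have hρ2 : (|Γ| / √(P₁ * P₂)) ^ 2 = Γ ^ 2 / (P₁ * P₂) := by rw [div_pow, sq_abs, hs2]
  have he₁ : P₁ * (1 - (|Γ| / √(P₁ * P₂)) ^ 2) = P₁ - Γ ^ 2 / P₂ := by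
    rw [hρ2]; field_simp
  have he₂ : P₂ * (1 - (|Γ| / √(P₁ * P₂)) ^ 2) = P₂ - Γ ^ 2 / P₁ := by
    rw [hρ2]; field_simp
  have hM : ∀ ν, (1 : ℝ) ≤ M ν := fun ν => by exact_mod_cast c.card_pos ν
  -- User 1 has weight zero, and the weight `1 + Γ / P₂` of user 2 makes the prediction gap equal to
  -- `X₁ - (Γ / P₂) X₂`.
  have b₁ := c.rate_le hn hN hL2 ![0, 1 + Γ / P₂] (S := N + (P₁ - Γ ^ 2 / P₂)) (by linarith)
    (hM 0) (c.sum_single_le (by linarith) (ν := 0) (ν' := 1) (by decide) rfl) (by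
      rw [hquad fun ν => 1 - (![0, 1 + Γ / P₂] : Fin 2 → ℝ) ν]
      refine add_le_add_right (le_trans (le_of_eq ?_) hle₁) N
      simp)
  have b₂ := c.rate_le hn hN hL2 ![1 + Γ / P₁, 0] (S := N + (P₂ - Γ ^ 2 / P₁)) (by linarith)
    (hM 1) (c.sum_single_le (by linarith) (ν := 1) (ν' := 0) (by decide) rfl) (by
      rw [hquad fun ν => 1 - (![1 + Γ / P₁, 0] : Fin 2 → ℝ) ν]
      refine add_le_add_right (le_trans (le_of_eq ?_) hle₂) N
      simp)
  have b₃ := c.rate_le hn hN hL2 0 (S := N + (P₁ + P₂ + 2 * Γ)) (by linarith)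
    (one_le_mul_of_one_le_of_one_le (hM 0) (hM 1)) (c.sum_joint_le (by linarith)) (by
      rw [hquad fun ν => 1 - (0 : Fin 2 → ℝ) ν]
      simp only [Pi.zero_apply]
      linarith)
  rw [Real.log_mul (by linarith [hM 0]) (by linarith [hM 1])] at b₃
  have hb : ∀ {x y : ℝ}, x ≤ n * y → 1 / n * x ≤ y := by
    intro x y h
    rw [one_div_mul_eq_div, div_le_iff₀ hn']; linarith
  have b₁' := hb b₁
  have b₂' := hb b₂
  have b₃' := hb b₃
  -- The absolute value is harmless: the single-user bounds depend on `Γ ^ 2` only, and the sum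
  -- bound can only grow.
  refine ⟨|Γ| / √(P₁ * P₂), ⟨by positivity, ?_⟩, ?_, ?_, ?_⟩
  · have : 0 ≤ P₁ * (1 - (|Γ| / √(P₁ * P₂)) ^ 2) := by rw [he₁]; exact hnn₁
    have := nonneg_of_mul_nonneg_right this hP₁
    nlinarith [div_nonneg (abs_nonneg Γ) hs.le]
  · rw [he₁]
    refine le_trans (le_of_eq ?_) (b₁'.trans (le_of_eq ?_))
    · simp only; ring
    · congr 2; field_simp
  · rw [he₂]
    refine le_trans (le_of_eq ?_) (b₂'.trans (le_of_eq ?_))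
    · simp only; ring
    · congr 2; field_simp
  · refine le_trans ?_ (b₃'.trans ?_)
    · have : 0 < 1 / (n : ℝ) := by positivity
      simp only
      linarith
    · have e : 2 * √(P₁ * P₂) * (|Γ| / √(P₁ * P₂)) = 2 * |Γ| := by field_simp
      rw [e]
      have := le_abs_self Γ
      refine mul_le_mul_of_nonneg_left (Real.log_le_log (by positivity) ?_) (by norm_num)
      gcongr ?_ / N
      linarith

/-- The correlations of a convergent sequence of points lie in a compact interval, and the three
bounds pass to the limit along a subsequence. -/
lemma isClosed_ozOuter {P₁ P₂ N : ℝ} (hP₁ : 0 < P₁) (hP₂ : 0 < P₂) (hN : 0 < N) :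
    IsClosed (ozOuter P₁ P₂ N) := by
  refine IsSeqClosed.isClosed fun x R hx hR => ?_
  choose ρ hρ h1 h2 h3 using hx
  obtain ⟨ρ₀, hρ₀, φ, hφ, hlim⟩ := isCompact_Icc.tendsto_subseq hρ
  have hR' := hR.comp hφ.tendsto_atTop
  have hq : 0 ≤ 1 - ρ₀ ^ 2 := by nlinarith [hρ₀.1, hρ₀.2]
  have hs := Real.sqrt_nonneg (P₁ * P₂)
  have hS : 0 < P₁ + P₂ + 2 * √(P₁ * P₂) * ρ₀ + N := by
    have := mul_nonneg hs hρ₀.1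
    linarith
  have hR1 : Filter.Tendsto (fun n => (x (φ n)).1) Filter.atTop (𝓝 R.1) :=
    (continuous_fst.tendsto R).comp hR'
  have hR2 : Filter.Tendsto (fun n => (x (φ n)).2) Filter.atTop (𝓝 R.2) :=
    (continuous_snd.tendsto R).comp hR'
  have hlim' : Filter.Tendsto (fun n => ρ (φ n)) Filter.atTop (𝓝 ρ₀) := hlim
  refine ⟨ρ₀, hρ₀, ?_, ?_, ?_⟩
  · refine le_of_tendsto_of_tendsto' hR1 (Filter.Tendsto.const_mul _ (Filter.Tendsto.log
      ((((hlim'.pow 2).const_sub 1).const_mul P₁).div_const N |>.const_add 1) ?_))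
      fun n => h1 (φ n)
    positivity
  · refine le_of_tendsto_of_tendsto' hR2 (Filter.Tendsto.const_mul _ (Filter.Tendsto.log
      ((((hlim'.pow 2).const_sub 1).const_mul P₂).div_const N |>.const_add 1) ?_))
      fun n => h2 (φ n)
    positivity
  · refine le_of_tendsto_of_tendsto' (hR1.add hR2) (Filter.Tendsto.const_mul _ (Filter.Tendsto.log
      (((hlim'.const_mul (2 * √(P₁ * P₂))).const_add (P₁ + P₂)).add_const N |>.div_const N) ?_))
      fun n => h3 (φ n)
    positivity

lemma ozOuter_mono {P₁ P₂ N : ℝ} {R R' : ℝ × ℝ} (h : R' ∈ ozOuter P₁ P₂ N) (h₁ : R.1 ≤ R'.1)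
    (h₂ : R.2 ≤ R'.2) : R ∈ ozOuter P₁ P₂ N := by
  obtain ⟨ρ, hρ, a, b, d⟩ := h
  exact ⟨ρ, hρ, h₁.trans a, h₂.trans b, (add_le_add h₁ h₂).trans d⟩

theorem capPerfectFB_subset_ozOuter {P₁ P₂ N : ℝ} (hP₁ : 0 < P₁) (hP₂ : 0 < P₂) (hN : 0 < N) :
    capPerfectFB P₁ P₂ N ⊆ ozOuter P₁ P₂ N := by
  rintro R ⟨-, -, hR⟩
  have hcl := isClosed_ozOuter hP₁ hP₂ hN
  have hδ : ∀ δ > 0, (R.1 - δ, R.2 - δ) ∈ ozOuter P₁ P₂ N := by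
    intro δ hδ
    obtain ⟨M, c, hc, herr⟩ := hR δ hδ
    have hlim : ∀ r : ℝ, Filter.Tendsto (fun n : ℕ => (1 - (c n).errorProb N 0) * (r - δ) - 1 / n)
        Filter.atTop (𝓝 (r - δ)) := by
      intro r
      have := ((herr.const_sub 1).mul_const (r - δ)).sub tendsto_one_div_atTop_nhds_zero_nat
      simpa using this
    refine hcl.mem_of_tendsto ((hlim R.1).prodMk_nhds (hlim R.2)) ?_
    -- An error probability below one keeps the factor `1 - errorProb` nonnegative, so the rate
    -- inequalities may be multiplied by it.
    filter_upwards [hc, Filter.eventually_gt_atTop 0,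
      herr.eventually (gt_mem_nhds one_pos)] with n hn hn0 hPe
    refine ozOuter_mono ((c n).mem_ozOuter hn0 hP₁ hP₂ hN hn.1 hn.2.1) ?_ ?_
    · have := mul_le_mul_of_nonneg_left hn.2.2.1.le (sub_nonneg.2 hPe.le)
      simp only
      linarith
    · have := mul_le_mul_of_nonneg_left hn.2.2.2.le (sub_nonneg.2 hPe.le)
      simp only
      linarith
  have hlim : Filter.Tendsto (fun δ : ℝ => (R.1 - δ, R.2 - δ)) (𝓝[>] 0) (𝓝 R) := by
    have : Continuous fun δ : ℝ => (R.1 - δ, R.2 - δ) := by fun_prop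
    have h := this.tendsto 0
    simp only [sub_zero, Prod.mk.eta] at h
    exact h.mono_left nhdsWithin_le_nhds
  exact hcl.mem_of_tendsto hlim (Filter.eventually_of_mem self_mem_nhdsWithin hδ)

/-! ### Covering the outer bound by Ozarow's rectangles -/

/-- After division, `RhoEq` says that the sum bound equals the sum of the two single-user bounds, so
at `ρ*` the two families of rectangles meet. -/
lemma RhoEq.div_eq {P₁ P₂ N ρ : ℝ} (h : RhoEq P₁ P₂ N ρ) (hP₁ : 0 < P₁) (hN : 0 < N)
    (hρ : ρ ∈ Set.Icc (0 : ℝ) 1) :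
    (P₁ + P₂ + 2 * √(P₁ * P₂) * ρ + N) / (P₁ * (1 - ρ ^ 2) + N) = 1 + P₂ * (1 - ρ ^ 2) / N := by
  have hq : 0 ≤ 1 - ρ ^ 2 := by nlinarith [hρ.1, hρ.2]
  have h1 : 0 < P₁ * (1 - ρ ^ 2) + N := by positivity
  rw [div_eq_iff h1.ne']
  unfold RhoEq at h
  field_simp
  linarith

lemma RhoEq.symm {P₁ P₂ N ρ : ℝ} (h : RhoEq P₁ P₂ N ρ) : RhoEq P₂ P₁ N ρ := by
  unfold RhoEq at *
  rw [mul_comm P₂ P₁]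
  linarith

lemma rhoStar_comm {P₁ P₂ N : ℝ} (hP₁ : 0 < P₁) (hP₂ : 0 < P₂) (hN : 0 < N) :
    rhoStar P₂ P₁ N = rhoStar P₁ P₂ N := by
  have h := rhoStar_spec hP₂ hP₁ hN
  have h' := rhoStar_spec hP₁ hP₂ hN
  exact (existsUnique_rhoEq hP₁ hP₂ hN).unique ⟨h.1, h.2.symm⟩ h'

lemma ozRect₂_eq (P₁ P₂ N ρ : ℝ) : ozRect₂ P₁ P₂ N ρ = Prod.swap ⁻¹' ozRect₁ P₂ P₁ N ρ := by
  ext R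
  simp only [ozRect₁, ozRect₂, Set.mem_preimage, Set.mem_ofPred_eq, Prod.fst_swap, Prod.snd_swap,
    mul_comm P₂ P₁, add_comm P₂ P₁]
  tauto

/-- The sum bound increases with the correlation; subtracting the exact value of `R.1` from the sum
bound at `ρ'` leaves the second side of the rectangle. -/
lemma mem_ozRect₁_of_mem_pentagon {P₁ P₂ N ρ ρ' : ℝ} (hP₁ : 0 < P₁) (hP₂ : 0 < P₂) (hN : 0 < N)
    (hρ : 0 ≤ ρ) (hρ' : ρ' ∈ Set.Icc ρ 1) {R : ℝ × ℝ} (h1 : 0 ≤ R.1) (h2 : 0 ≤ R.2)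
    (hR1 : R.1 = 1 / 2 * Real.log (1 + P₁ * (1 - ρ' ^ 2) / N))
    (hR : R.1 + R.2 ≤ 1 / 2 * Real.log ((P₁ + P₂ + 2 * √(P₁ * P₂) * ρ + N) / N)) :
    R ∈ ozRect₁ P₁ P₂ N ρ' := by
  have hq : 0 ≤ 1 - ρ' ^ 2 := by nlinarith [hρ'.1, hρ'.2]
  have hs := Real.sqrt_nonneg (P₁ * P₂)
  have hS : 0 < P₁ + P₂ + 2 * √(P₁ * P₂) * ρ + N := by positivity
  have hS' : 0 < P₁ + P₂ + 2 * √(P₁ * P₂) * ρ' + N := by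
    have := hρ.trans hρ'.1
    positivity
  have hle : P₁ + P₂ + 2 * √(P₁ * P₂) * ρ + N ≤ P₁ + P₂ + 2 * √(P₁ * P₂) * ρ' + N := by
    have := mul_le_mul_of_nonneg_left hρ'.1 hs
    linarith
  have hlog := Real.log_le_log hS hle
  have hD : 0 < P₁ * (1 - ρ' ^ 2) + N := by positivity
  have e : 1 + P₁ * (1 - ρ' ^ 2) / N = (P₁ * (1 - ρ' ^ 2) + N) / N := by field_simp; ring
  refine ⟨h1, h2, hR1.le, ?_⟩
  rw [e, Real.log_div hD.ne' hN.ne'] at hR1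
  rw [Real.log_div hS.ne' hN.ne'] at hR
  rw [Real.log_div hS'.ne' hD.ne']
  linarith

/-- The single-user bound decreases with the correlation. Since `R.1` exceeds its value at `ρ*`,
this forces `ρ ≤ ρ*`, and the bound takes the value `R.1` somewhere in between. -/
lemma exists_mem_ozRect₁ {P₁ P₂ N ρ : ℝ} (hP₁ : 0 < P₁) (hP₂ : 0 < P₂) (hN : 0 < N)
    (hρ : ρ ∈ Set.Icc (0 : ℝ) 1) {R : ℝ × ℝ} (h1 : 0 ≤ R.1) (h2 : 0 ≤ R.2)
    (hR1 : R.1 ≤ 1 / 2 * Real.log (1 + P₁ * (1 - ρ ^ 2) / N))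
    (hR : R.1 + R.2 ≤ 1 / 2 * Real.log ((P₁ + P₂ + 2 * √(P₁ * P₂) * ρ + N) / N))
    (hlt : 1 / 2 * Real.log (1 + P₁ * (1 - rhoStar P₁ P₂ N ^ 2) / N) < R.1) :
    ∃ ρ' ∈ Set.Icc 0 (rhoStar P₁ P₂ N), R ∈ ozRect₁ P₁ P₂ N ρ' := by
  obtain ⟨hs, -⟩ := rhoStar_spec hP₁ hP₂ hN
  set τ := rhoStar P₁ P₂ N
  have hlt' : ρ ≤ τ := by
    by_contra hcon
    push Not at hcon
    refine absurd (hlt.trans_le hR1) (not_lt.2 ?_)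
    have hq : 0 ≤ 1 - ρ ^ 2 := by nlinarith [hρ.1, hρ.2]
    have : τ ^ 2 ≤ ρ ^ 2 := pow_le_pow_left₀ hs.1 hcon.le 2
    refine mul_le_mul_of_nonneg_left (Real.log_le_log (by positivity) ?_) (by norm_num)
    gcongr
  have hcont : ContinuousOn (fun x : ℝ => 1 / 2 * Real.log (1 + P₁ * (1 - x ^ 2) / N))
      (Set.Icc ρ τ) := by
    refine ContinuousOn.mul continuousOn_const (ContinuousOn.log (by fun_prop) fun x hx => ?_)
    have hq : 0 ≤ 1 - x ^ 2 := by nlinarith [hρ.1, hx.1, hx.2, hs.2]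
    positivity
  obtain ⟨ρ', hρ', hρ'R⟩ := intermediate_value_Icc' hlt' hcont ⟨hlt.le, hR1⟩
  exact ⟨ρ', ⟨hρ.1.trans hρ'.1, hρ'.2⟩, mem_ozRect₁_of_mem_pentagon hP₁ hP₂ hN hρ.1
    ⟨hρ'.1, hρ'.2.trans hs.2⟩ h1 h2 hρ'R.symm hR⟩

/-- The nonnegative part of the outer bound is covered by Ozarow's rectangles. -/
lemma exists_mem_ozRect {P₁ P₂ N : ℝ} (hP₁ : 0 < P₁) (hP₂ : 0 < P₂) (hN : 0 < N) {R : ℝ × ℝ}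
    (h1 : 0 ≤ R.1) (h2 : 0 ≤ R.2) (hR : R ∈ ozOuter P₁ P₂ N) :
    ∃ ρ ∈ Set.Icc 0 (rhoStar P₁ P₂ N), R ∈ ozRect₁ P₁ P₂ N ρ ∨ R ∈ ozRect₂ P₁ P₂ N ρ := by
  obtain ⟨ρ, hρ, b₁, b₂, b₃⟩ := hR
  obtain ⟨hs, he⟩ := rhoStar_spec hP₁ hP₂ hN
  -- Either `R` lies below the common corner at `ρ*`, or one rate exceeds its coordinate there, and
  -- that user's family of rectangles is used.
  by_cases c₁ : R.1 ≤ 1 / 2 * Real.log (1 + P₁ * (1 - rhoStar P₁ P₂ N ^ 2) / N)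
  · by_cases c₂ : R.2 ≤ 1 / 2 * Real.log (1 + P₂ * (1 - rhoStar P₁ P₂ N ^ 2) / N)
    · refine ⟨_, ⟨hs.1, le_rfl⟩, Or.inl ⟨h1, h2, c₁, ?_⟩⟩
      rwa [he.div_eq hP₁ hN hs]
    · push Not at c₂
      rw [← rhoStar_comm hP₁ hP₂ hN] at c₂
      rw [mul_comm P₁ P₂, add_comm P₁ P₂, add_comm R.1] at b₃
      obtain ⟨ρ', hρ', hR'⟩ := exists_mem_ozRect₁ (R := R.swap) hP₂ hP₁ hN hρ h2 h1 b₂ b₃ c₂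
      refine ⟨ρ', rhoStar_comm hP₁ hP₂ hN ▸ hρ', Or.inr ?_⟩
      rw [ozRect₂_eq]
      exact hR'
  · push Not at c₁
    obtain ⟨τ, hτ, hRτ⟩ := exists_mem_ozRect₁ hP₁ hP₂ hN hρ h1 h2 b₁ b₃ c₁
    exact ⟨τ, hτ, Or.inl hRτ⟩

/-- The power split for which Ozarow's operating point of correlation `ρ` is the sum of the
full-cooperation point of a smaller user-1 power and a part sent without feedback. -/
lemma exists_power_split {P₁ P₂ N ρ : ℝ} (hP₁ : 0 < P₁) (hP₂ : 0 < P₂) (hN : 0 < N)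
    (hρ : ρ ∈ Set.Ioc 0 (rhoStar P₁ P₂ N)) :
    ∃ Q ∈ Set.Ioc 0 P₁, ∃ r ∈ Set.Ioo (0 : ℝ) 1, Q * r ^ 2 = P₁ * ρ ^ 2 ∧
      √(Q * P₂) * r = √(P₁ * P₂) * ρ ∧ RhoEq Q P₂ (N + (P₁ - Q)) r := by
  obtain ⟨hs, he⟩ := rhoStar_spec hP₁ hP₂ hN
  have hρ0 := hρ.1
  have hρ1 : ρ ≤ 1 := hρ.2.trans hs.2
  have hρsq : ρ ^ 2 ≤ 1 := pow_le_one₀ hρ0.le hρ1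
  have hs0 : 0 < √(P₁ * P₂) := Real.sqrt_pos.2 (mul_pos hP₁ hP₂)
  -- With `r² = ρ² P₁ / Q`, a zero of `f` is a solution of `RhoEq Q P₂ (N + (P₁ - Q)) r`. At the
  -- lower end `r = 1` and `f ≤ 0`; at `Q = P₁` one has `r = ρ ≤ ρ*` and `f ≥ 0`.
  let f : ℝ → ℝ := fun Q => (N + P₁ - ρ ^ 2 * P₁) * (N + (P₁ - Q) + P₂ * (1 - ρ ^ 2 * P₁ / Q)) -
    (N + (P₁ - Q)) * (N + P₁ + P₂ + 2 * √(P₁ * P₂) * ρ)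
  have hlo : 0 < ρ ^ 2 * P₁ := by positivity
  have hle : ρ ^ 2 * P₁ ≤ P₁ := by nlinarith
  have hcont : ContinuousOn f (Set.Icc (ρ ^ 2 * P₁) P₁) := by
    have : ContinuousOn (fun Q : ℝ => ρ ^ 2 * P₁ / Q) (Set.Icc (ρ ^ 2 * P₁) P₁) :=
      continuousOn_const.div continuousOn_id fun x hx => (hlo.trans_le hx.1).ne'
    fun_prop
  have hf0 : f (ρ ^ 2 * P₁) ≤ 0 := by
    have h1 : 0 < N + (P₁ - ρ ^ 2 * P₁) := by linarith
    have h2 : 0 < √(P₁ * P₂) * ρ := by positivity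
    have e : f (ρ ^ 2 * P₁) = (N + (P₁ - ρ ^ 2 * P₁)) *
        (-(ρ ^ 2 * P₁) - P₂ - 2 * (√(P₁ * P₂) * ρ)) := by
      simp only [f]
      rw [div_self hlo.ne']
      ring
    rw [e]
    exact mul_nonpos_of_nonneg_of_nonpos h1.le (by linarith)
  have hf1 : 0 ≤ f P₁ := by
    have hsq : ρ ^ 2 ≤ rhoStar P₁ P₂ N ^ 2 := pow_le_pow_left₀ hρ0.le hρ.2 2
    have hy2 : rhoStar P₁ P₂ N ^ 2 ≤ 1 := pow_le_one₀ hs.1 hs.2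
    have e1 : (N + P₁ * (1 - rhoStar P₁ P₂ N ^ 2)) * (N + P₂ * (1 - rhoStar P₁ P₂ N ^ 2)) ≤
        (N + P₁ * (1 - ρ ^ 2)) * (N + P₂ * (1 - ρ ^ 2)) := by
      have := sub_nonneg.2 hy2
      gcongr
    have e2 : N * (2 * √(P₁ * P₂) * ρ) ≤ N * (2 * √(P₁ * P₂) * rhoStar P₁ P₂ N) := by
      have := hρ.2
      gcongr
    unfold RhoEq at he
    simp only [f]
    rw [mul_div_assoc, div_self hP₁.ne']
    nlinarith
  obtain ⟨Q, hQ, hfQ⟩ := intermediate_value_Icc hle hcont ⟨hf0, hf1⟩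
  have hQ0 : 0 < Q := hlo.trans_le hQ.1
  have hr2 : (ρ * √(P₁ / Q)) ^ 2 = ρ ^ 2 * P₁ / Q := by
    rw [mul_pow, Real.sq_sqrt (by positivity)]; ring
  have hr0 : 0 < ρ * √(P₁ / Q) := mul_pos hρ0 (Real.sqrt_pos.2 (by positivity))
  have hsr : √(Q * P₂) * (ρ * √(P₁ / Q)) = √(P₁ * P₂) * ρ := by
    have : √(P₁ * P₂) = √(Q * P₂) * √(P₁ / Q) := by
      rw [← Real.sqrt_mul (by positivity)]
      congr 1
      field_simp
    rw [this]; ring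
  have hQr : Q * (ρ * √(P₁ / Q)) ^ 2 = P₁ * ρ ^ 2 := by
    rw [hr2]; field_simp
  have hrho : RhoEq Q P₂ (N + (P₁ - Q)) (ρ * √(P₁ / Q)) := by
    unfold RhoEq
    rw [mul_assoc 2, hsr, hr2]
    simp only [f] at hfQ
    have e : N + (P₁ - Q) + Q * (1 - ρ ^ 2 * P₁ / Q) = N + P₁ - ρ ^ 2 * P₁ := by field_simp; ring
    rw [e]
    linarith
  refine ⟨Q, ⟨hQ0, hQ.2⟩, _, ⟨hr0, ?_⟩, hQr, hsr, hrho⟩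
  by_contra hcon
  push Not at hcon
  have h1 : (ρ * √(P₁ / Q)) ^ 2 ≤ 1 := by
    rw [hr2, div_le_one hQ0]; exact hQ.1
  have h2 : ρ * √(P₁ / Q) = 1 := le_antisymm (by nlinarith) hcon
  rw [h2] at hrho
  unfold RhoEq at hrho
  have hN' : 0 < N + (P₁ - Q) := by linarith [hQ.2]
  have : 0 < √(Q * P₂) := Real.sqrt_pos.2 (mul_pos hQ0 hP₂)
  nlinarith [mul_pos hN' hQ0, mul_pos hN' hP₂, mul_pos hN' this]

/-! ### Linear feedback schemes that transmit estimation errors -/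

/-- The posterior precision matrix of two standard Gaussian message symbols after `t` uses of
the channel with noise variance `N` and channel gains `α`. -/
def precision (N : ℝ) (α : ℕ → Fin 2 → ℝ) (t : ℕ) : Matrix (Fin 2) (Fin 2) ℝ :=
  1 + N⁻¹ • ∑ s ∈ Finset.range t, Matrix.vecMulVec (α s) (α s)

lemma precision_succ (N : ℝ) (α : ℕ → Fin 2 → ℝ) (t : ℕ) :
    precision N α (t + 1) = precision N α t + N⁻¹ • Matrix.vecMulVec (α t) (α t) := by
  simp [precision, Finset.sum_range_succ, add_assoc]

lemma posDef_precision {N : ℝ} (hN : 0 < N) (α : ℕ → Fin 2 → ℝ) (t : ℕ) :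
    (precision N α t).PosDef := by
  induction t with
  | zero => simpa [precision] using Matrix.PosDef.one
  | succ t ih =>
    rw [precision_succ]
    refine ih.add_posSemidef (Matrix.PosSemidef.smul ?_ (inv_nonneg.2 hN.le))
    simpa using Matrix.posSemidef_vecMulVec_self_star (α t)

section scheme

variable {η : ℕ} (N : ℝ) (α : ℕ → Fin 2 → ℝ)

/-- The weights with which user `ν` subtracts its linear estimate of its own message symbol. -/
def estWeight (η : ℕ) (ν : Fin 2) : Matrix (Fin η) (Fin η) ℝ :=
  Matrix.of fun i j => if j < i then
    -(α i ν * ((precision N α i)⁻¹ *ᵥ α j) ν / N) else 0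

lemma estWeight_of_le (ν : Fin 2) {i j : Fin η} (h : i ≤ j) : estWeight N α η ν i j = 0 := by
  simp [estWeight, not_lt.2 h]

/-- The unit lower triangular matrix `I + L₁ + L₂`. -/
def estUnit (η : ℕ) : Matrix (Fin η) (Fin η) ℝ := 1 + (estWeight N α η 0 + estWeight N α η 1)

lemma estUnit_lower {i j : Fin η} (h : i < j) : estUnit N α η i j = 0 := by
  simp [estUnit, estWeight_of_le N α _ h.le, h.ne]

lemma det_estUnit : (estUnit N α η).det = 1 := by
  rw [Matrix.det_of_isLowerTriangular _ fun i j h => estUnit_lower N α h]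
  refine Finset.prod_eq_one fun i _ => ?_
  simp [estUnit, estWeight_of_le N α _ (le_refl i)]

lemma estUnit_inv_lower {i j : Fin η} (h : i < j) : (estUnit N α η)⁻¹ i j = 0 := by
  have hdet : IsUnit (estUnit N α η).det := by rw [det_estUnit]; exact isUnit_one
  have := (estUnit N α η).invertibleOfIsUnitDet hdet
  have hlow : (estUnit N α η).BlockTriangular (OrderDual.toDual : Fin η → (Fin η)ᵒᵈ) :=
    fun i j h => estUnit_lower N α h
  exact Matrix.blockTriangular_inv_of_blockTriangular hlow h

/-- The scheme in which user `ν` transmits `α_{t,ν}` times the error of the linear MMSE estimate of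
its message symbol from the past channel outputs (without feedback noise). -/
def errorScheme (η : ℕ) : Params η where
  a ν i := α i ν
  -- Let `ỹ_t = α_t · θ + z_t`. The inputs `a_ν θ_ν + L_ν ỹ` produce the output `y = (I + L₁ + L₂)
  -- ỹ`, so the inverse recovers `ỹ` from the feedback.
  B ν := estWeight N α η ν * (estUnit N α η)⁻¹
  C := Matrix.of fun ν i => α i ν
  strictLower ν i j h := by
    rw [Matrix.mul_apply]
    refine Finset.sum_eq_zero fun k _ => ?_
    rcases lt_or_ge k i with hk | hk
    · rw [estUnit_inv_lower N α (hk.trans_le h), mul_zero]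
    · rw [estWeight_of_le N α ν hk, zero_mul]

/-- The matrix `L₁` on top of `L₂`. -/
def estStack (η : ℕ) : Matrix (Fin 2 × Fin η) (Fin η) ℝ :=
  Matrix.of fun x j => estWeight N α η x.1 x.2 j

/-- The matrix `(I I)`. -/
def blockSum (η : ℕ) : Matrix (Fin η) (Fin 2 × Fin η) ℝ :=
  Matrix.of fun i y => (1 : Matrix (Fin η) (Fin η) ℝ) i y.2

lemma blockSum_mul {κ : Type*} (X : Matrix (Fin 2 × Fin η) κ ℝ) :
    blockSum η * X = Matrix.of fun i k => X (0, i) k + X (1, i) k := by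
  ext i k
  simp [blockSum, Matrix.mul_apply, Fintype.sum_prod_type, Fin.sum_univ_two, Matrix.one_apply]

lemma BB_errorScheme : (errorScheme N α η).BB = (errorScheme N α η).Bt * blockSum η := by
  ext x y
  simp [Params.BB, Params.Bt, blockSum, Matrix.mul_apply, Matrix.one_apply]

lemma Bt_errorScheme : (errorScheme N α η).Bt = estStack N α η * (estUnit N α η)⁻¹ := by
  ext x j
  simp [Params.Bt, estStack, errorScheme, Matrix.mul_apply]

lemma blockSum_mul_estStack :
    blockSum η * estStack N α η = estWeight N α η 0 + estWeight N α η 1 := by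
  rw [blockSum_mul]; ext i j; simp [estStack]

lemma blockSum_mul_Ad (p : Params η) : blockSum η * p.Ad = p.Ab := by
  rw [blockSum_mul]
  ext i μ
  fin_cases μ <;> simp [Params.Ad, Params.Ab]

/-- A push-through identity: `BB = T U⁻¹ J` with `U = 1 + J T`, hence `(1 - T U⁻¹ J)(1 + T J) = 1`.
-/
lemma inv_one_sub_BB : (1 - (errorScheme N α η).BB)⁻¹ = 1 + estStack N α η * blockSum η := by
  refine Matrix.inv_eq_right_inv ?_
  have hdet : IsUnit (estUnit N α η).det := by rw [det_estUnit]; exact isUnit_one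
  have h1 : (estUnit N α η)⁻¹ * estUnit N α η = 1 := Matrix.nonsing_inv_mul _ hdet
  set U := (estUnit N α η)⁻¹
  set T := estStack N α η
  set J := blockSum η
  have hJT : J * T = estUnit N α η - 1 := by
    rw [blockSum_mul_estStack]; simp [estUnit]
  have h2 : T * U * J * (T * J) = T * J - T * U * J := by
    calc T * U * J * (T * J) = T * (U * (J * T)) * J := by simp only [Matrix.mul_assoc]
      _ = T * J - T * U * J := by
        rw [hJT, Matrix.mul_sub, h1, Matrix.mul_one, Matrix.mul_sub, Matrix.mul_one, Matrix.sub_mul]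
  rw [BB_errorScheme, Bt_errorScheme, Matrix.sub_mul, Matrix.mul_add, Matrix.mul_add, h2,
    Matrix.one_mul, Matrix.one_mul, Matrix.mul_one]
  change 1 + T * J - (T * U * J + (T * J - T * U * J)) = 1
  abel

lemma inv_mul_Bt : (1 + estStack N α η * blockSum η) * (errorScheme N α η).Bt =
    estStack N α η := by
  have hdet : IsUnit (estUnit N α η).det := by rw [det_estUnit]; exact isUnit_one
  have h1 : estUnit N α η * (estUnit N α η)⁻¹ = 1 := Matrix.mul_nonsing_inv _ hdet
  rw [Bt_errorScheme]
  calc (1 + estStack N α η * blockSum η) * (estStack N α η * (estUnit N α η)⁻¹)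
      = estStack N α η * ((1 + blockSum η * estStack N α η) * (estUnit N α η)⁻¹) := by
        rw [Matrix.add_mul, Matrix.add_mul, Matrix.mul_add, Matrix.one_mul, Matrix.one_mul]
        simp only [Matrix.mul_assoc]
    _ = estStack N α η := by
        rw [blockSum_mul_estStack]
        change estStack N α η * (estUnit N α η * (estUnit N α η)⁻¹) = _
        rw [h1, Matrix.mul_one]

lemma sum_fin_ite_lt {β : Type*} [AddCommMonoid β] (i : Fin η) (f : ℕ → β) :
    ∑ j : Fin η, (if j < i then f j else 0) = ∑ s ∈ Finset.range i, f s := by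
  simp_rw [Fin.lt_def]
  rw [Fin.sum_univ_eq_sum_range (fun j => if j < (i : ℕ) then f j else 0) η, ← Finset.sum_filter]
  congr 1
  ext s
  simp only [Finset.mem_filter, Finset.mem_range]
  have := i.2
  omega

lemma sum_vecMulVec {N : ℝ} (hN : 0 < N) (t : ℕ) :
    ∑ s ∈ Finset.range t, Matrix.vecMulVec (α s) (α s) = N • (precision N α t - 1) := by
  simp [precision, smul_smul, hN.ne']

/-- The coefficients of the message symbols in the inputs. With `G` the precision matrix, the
estimate removes `G⁻¹ (G - 1)` from the identity and leaves `G⁻¹`. -/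
lemma inv_mul_Ad_apply {N : ℝ} (hN : 0 < N) (ν μ : Fin 2) (i : Fin η) :
    ((1 + estStack N α η * blockSum η) * (errorScheme N α η).Ad :
      Matrix (Fin 2 × Fin η) (Fin 2) ℝ) (ν, i) μ =
      α i ν * (precision N α i)⁻¹ ν μ := by
  have hG := (posDef_precision hN α i).det_pos.ne'
  rw [Matrix.add_mul, Matrix.one_mul, Matrix.mul_assoc, blockSum_mul_Ad, Matrix.add_apply,
    Matrix.mul_apply]
  have h1 : ∀ j : Fin η, estStack N α η (ν, i) j * (errorScheme N α η).Ab j μ =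
      if j < i then -(α i ν / N * ((precision N α i)⁻¹ * Matrix.vecMulVec (α j) (α j)) ν μ)
        else 0 := by
    intro j
    by_cases h : j < i
    · simp [estStack, estWeight, h, Params.Ab, errorScheme, Matrix.mul_vecMulVec,
        Matrix.vecMulVec_apply]
      ring
    · simp [estStack, estWeight, h]
  simp_rw [h1]
  rw [sum_fin_ite_lt i fun s =>
    -(α i ν / N * ((precision N α i)⁻¹ * Matrix.vecMulVec (α s) (α s)) ν μ),
    Finset.sum_neg_distrib, ← Finset.mul_sum, ← Matrix.sum_apply, ← Matrix.mul_sum,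
    sum_vecMulVec α hN, Matrix.mul_smul, Matrix.mul_sub,
    Matrix.nonsing_inv_mul _ (isUnit_iff_ne_zero.2 hG)]
  have h2 : (errorScheme N α η).Ad (ν, i) μ =
      α i ν * (1 : Matrix (Fin 2) (Fin 2) ℝ) ν μ := by
    simp [Params.Ad, errorScheme, Matrix.one_apply]
  rw [h2]
  simp only [Matrix.smul_apply, Matrix.sub_apply, Matrix.mul_one, smul_eq_mul]
  field_simp
  ring

/-- The noise part of the input power: summing the rank-one terms gives `G⁻¹ (G - 1) G⁻¹ = G⁻¹ -
(G⁻¹)²`. -/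
lemma sum_estStack_sq {N : ℝ} (hN : 0 < N) (ν : Fin 2) (i : Fin η) :
    N * ∑ j, estStack N α η (ν, i) j ^ 2 =
      α i ν ^ 2 * ((precision N α i)⁻¹ ν ν - ∑ μ, (precision N α i)⁻¹ ν μ ^ 2) := by
  have hpd := posDef_precision hN α i
  have hG := hpd.det_pos.ne'
  have hsym : ((precision N α i)⁻¹)ᵀ = (precision N α i)⁻¹ := by
    have := hpd.inv.isHermitian
    rwa [Matrix.IsHermitian, Matrix.conjTranspose_eq_transpose_of_trivial] at this
  have h1 : ∀ j : Fin η, estStack N α η (ν, i) j ^ 2 =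
      if j < i then α i ν ^ 2 / N ^ 2 * ((precision N α i)⁻¹ * Matrix.vecMulVec (α j) (α j) *
        ((precision N α i)⁻¹)ᵀ) ν ν else 0 := by
    intro j
    by_cases h : j < i
    · rw [Matrix.mul_vecMulVec, Matrix.vecMulVec_mul, Matrix.vecMul_transpose]
      simp [estStack, estWeight, h, Matrix.vecMulVec_apply]
      ring
    · simp [estStack, estWeight, h]
  simp_rw [h1]
  rw [sum_fin_ite_lt i fun s => α i ν ^ 2 / N ^ 2 * ((precision N α i)⁻¹ *
      Matrix.vecMulVec (α s) (α s) * ((precision N α i)⁻¹)ᵀ) ν ν,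
    ← Finset.mul_sum, ← Matrix.sum_apply, ← Matrix.sum_mul, ← Matrix.mul_sum,
    sum_vecMulVec α hN, Matrix.mul_smul, Matrix.mul_sub,
    Matrix.nonsing_inv_mul _ (isUnit_iff_ne_zero.2 hG), Matrix.mul_one, Matrix.smul_mul,
    Matrix.sub_mul, Matrix.one_mul]
  have h3 : ((precision N α i)⁻¹ * ((precision N α i)⁻¹)ᵀ) ν ν =
      ∑ μ, (precision N α i)⁻¹ ν μ ^ 2 := by
    rw [Matrix.mul_apply]
    exact Finset.sum_congr rfl fun μ _ => by rw [Matrix.transpose_apply, sq]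
  rw [Matrix.smul_apply, Matrix.sub_apply, h3, hsym, smul_eq_mul]
  field_simp

/-- The powers of the transmitted estimation errors. -/
lemma inputCov_errorScheme_diag {N : ℝ} (hN : 0 < N) (ν : Fin 2) (i : Fin η) :
    (errorScheme N α η).inputCov N 0 (ν, i) (ν, i) = α i ν ^ 2 * (precision N α i)⁻¹ ν ν := by
  -- The message part contributes the diagonal of `(G⁻¹)²` and the noise part that of `G⁻¹ -
  -- (G⁻¹)²`; the squares cancel.
  have h : (errorScheme N α η).inputCov N 0 =
      ((1 + estStack N α η * blockSum η) * (errorScheme N α η).Ad :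
        Matrix (Fin 2 × Fin η) (Fin 2) ℝ) *
        ((1 + estStack N α η * blockSum η) * (errorScheme N α η).Ad)ᵀ +
      N • (estStack N α η * (estStack N α η)ᵀ) := by
    have hB := inv_mul_Bt (η := η) N α
    rw [Params.inputCov, inv_one_sub_BB]
    generalize 1 + estStack N α η * blockSum η = V at hB ⊢
    rw [← hB]
    simp only [Matrix.zero_kronecker, Matrix.mul_zero, Matrix.zero_mul, add_zero, Matrix.mul_add,
      Matrix.add_mul, Matrix.transpose_mul, Matrix.mul_smul, Matrix.smul_mul, Matrix.mul_assoc]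
  rw [h, Matrix.add_apply, Matrix.smul_apply, Matrix.mul_apply, Matrix.mul_apply]
  simp only [Matrix.transpose_apply, inv_mul_Ad_apply α hN, smul_eq_mul, ← sq]
  rw [sum_estStack_sq α hN]
  simp_rw [mul_pow, ← Finset.mul_sum]
  ring

end scheme

lemma noiseCov_zero {η : ℕ} (p : Params η) (N : ℝ) : p.noiseCov N 0 = N • 1 := by
  simp [Params.noiseCov]

/-! ### Rates of the error-transmitting schemes with noise-free feedback -/

section rates

variable {η : ℕ} (α : ℕ → Fin 2 → ℝ) {N : ℝ}

lemma C_mul_C_transpose (hN : 0 < N) : (errorScheme N α η).C * (errorScheme N α η).Cᵀ =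
    N • (precision N α η - 1) := by
  rw [← sum_vecMulVec α hN]
  ext μ ν
  rw [Matrix.mul_apply, Matrix.sum_apply, ← Fin.sum_univ_eq_sum_range
    (fun s => Matrix.vecMulVec (α s) (α s) μ ν)]
  simp [errorScheme, Matrix.vecMulVec_apply]

lemma Ab_errorScheme : (errorScheme N α η).Ab = (errorScheme N α η).Cᵀ := by
  ext i ν; simp [Params.Ab, errorScheme]

/-- With `W = C Cᵀ = N (G - 1)`, the numerator is the determinant of `W (W + N) = W (N G)` and the
denominator that of `N W`. The matched filter thus loses nothing. -/
lemma rateBound_joint (hN : 0 < N)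
    (hdet : ((errorScheme N α η).C * (errorScheme N α η).Cᵀ).det ≠ 0) :
    (errorScheme N α η).rateBound N 0 (errorScheme N α η).C
      ((errorScheme N α η).Ab * (errorScheme N α η).Abᵀ) =
      1 / (2 * (η : ℝ)) * Real.log (precision N α η).det := by
  have hW := C_mul_C_transpose (η := η) α hN
  set C := (errorScheme N α η).C
  rw [Params.rateBound, noiseCov_zero, Ab_errorScheme]
  congr 2
  have e1 : C * (Cᵀ * Cᵀᵀ + N • 1) * Cᵀ = (C * Cᵀ) * (N • precision N α η) := by
    have : N • precision N α η = C * Cᵀ + N • 1 := by rw [hW, smul_sub]; simp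
    rw [this, Matrix.transpose_transpose]
    simp only [Matrix.mul_add, Matrix.add_mul, Matrix.mul_smul, Matrix.smul_mul, Matrix.mul_one,
      Matrix.mul_assoc]
  have e2 : C * (N • (1 : Matrix (Fin η) (Fin η) ℝ)) * Cᵀ = N • (C * Cᵀ) := by simp
  change (C * (Cᵀ * Cᵀᵀ + N • (1 : Matrix (Fin η) (Fin η) ℝ)) * Cᵀ).det /
    (C * (N • (1 : Matrix (Fin η) (Fin η) ℝ)) * Cᵀ).det = _
  rw [e1, e2, Matrix.det_mul, Matrix.det_smul, Matrix.det_smul]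
  simp only [Fintype.card_fin]
  field_simp

/-- The signal term is the rank-one matrix `w wᵀ` with `w` the `ν`-th column of `W = C Cᵀ`, so the
ratio of determinants is `1 + wᵀ (N W)⁻¹ w = 1 + W ν ν / N`. -/
lemma rateBound_single (hN : 0 < N)
    (hdet : ((errorScheme N α η).C * (errorScheme N α η).Cᵀ).det ≠ 0) (ν : Fin 2) :
    (errorScheme N α η).rateBound N 0 (errorScheme N α η).C
      (Matrix.vecMulVec ((errorScheme N α η).a ν) ((errorScheme N α η).a ν)) =
      1 / (2 * (η : ℝ)) * Real.log (precision N α η ν ν) := by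
  have hW := C_mul_C_transpose (η := η) α hN
  have ha : (errorScheme N α η).a ν = (errorScheme N α η).C ν := rfl
  set C := (errorScheme N α η).C
  rw [Params.rateBound, noiseCov_zero, ha]
  congr 2
  have hsym : (C * Cᵀ) 1 0 = (C * Cᵀ) 0 1 := by
    simp only [Matrix.mul_apply, Matrix.transpose_apply, mul_comm]
  have hG : precision N α η ν ν = ((C * Cᵀ) ν ν + N) / N := by
    rw [hW, Matrix.smul_apply, Matrix.sub_apply, Matrix.one_apply_eq, smul_eq_mul]
    field_simp
    ring
  have e1 : C * (Matrix.vecMulVec (C ν) (C ν) + N • 1) * Cᵀ =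
      Matrix.vecMulVec ((C * Cᵀ)ᵀ ν) ((C * Cᵀ)ᵀ ν) + N • (C * Cᵀ) := by
    have h1 : C *ᵥ C ν = (C * Cᵀ)ᵀ ν := by
      ext μ; simp [Matrix.mulVec, dotProduct, Matrix.mul_apply]
    have h2 : C ν ᵥ* Cᵀ = (C * Cᵀ)ᵀ ν := by rw [Matrix.vecMul_transpose, h1]
    rw [Matrix.mul_add, Matrix.add_mul, Matrix.mul_vecMulVec, Matrix.vecMulVec_mul, h1, h2]
    simp
  have e2 : C * (N • (1 : Matrix (Fin η) (Fin η) ℝ)) * Cᵀ = N • (C * Cᵀ) := by simp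
  rw [e1, e2, hG, Matrix.det_smul]
  generalize C * Cᵀ = W at *
  rw [Matrix.det_fin_two] at hdet ⊢
  rw [Matrix.det_fin_two]
  simp only [Matrix.add_apply, Matrix.smul_apply, Matrix.vecMulVec_apply, Matrix.transpose_apply,
    smul_eq_mul, Fintype.card_fin, hsym] at hdet ⊢
  fin_cases ν
  · simp only [Fin.zero_eta, hsym]
    rw [div_eq_div_iff (mul_ne_zero (pow_ne_zero _ hN.ne') hdet) hN.ne']
    ring
  · simp only [Fin.mk_one]
    rw [div_eq_div_iff (mul_ne_zero (pow_ne_zero _ hN.ne') hdet) hN.ne']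
    ring

end rates

/-! ### Ozarow's scheme -/

/-- The channel gains: one use that creates the correlation `-ρ`, then `n` uses in which the
correlation of the estimation errors alternates between `ρ` and `-ρ`, then silence. -/
def ozGain (x κ₁ κ₂ a b : ℝ) (n : ℕ) : ℕ → Fin 2 → ℝ
  | 0 => ![x, x]
  | t + 1 => if t < n then ![κ₁ * a ^ t, -(κ₂ * (-b) ^ t)] else 0

/-- Each use multiplies the diagonal entries by `a²` and `b²` and the off-diagonal entry by `-(a *
b)`. The last factor is the stationarity condition `h₁₂`: the normalized correlation only changes
sign. -/
lemma precision_ozGain {N x κ₁ κ₂ a b ρ g P₁ P₂ : ℝ}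
    (hx : 1 + x ^ 2 / N = g) (hxρ : x ^ 2 / N = ρ * g)
    (h₁ : κ₁ ^ 2 = P₁ * (1 - ρ ^ 2) * g) (h₂ : κ₂ ^ 2 = P₂ * (1 - ρ ^ 2) * g)
    (ha : a ^ 2 = 1 + P₁ * (1 - ρ ^ 2) / N) (hb : b ^ 2 = 1 + P₂ * (1 - ρ ^ 2) / N)
    (h₁₂ : ρ * g - κ₁ * κ₂ / N = -(ρ * g * (a * b))) (n t : ℕ) (ht : t ≤ n) :
    precision N (ozGain x κ₁ κ₂ a b n) (t + 1) =
      !![g * (a ^ 2) ^ t, ρ * g * (-(a * b)) ^ t; ρ * g * (-(a * b)) ^ t, g * (b ^ 2) ^ t] := by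
  induction t with
  | zero =>
    have e : N⁻¹ * (x * x) = x ^ 2 / N := by ring
    ext i j
    fin_cases i <;> fin_cases j <;> simp [precision, ozGain] <;> linarith
  | succ t ih =>
    rw [precision_succ, ih (by omega)]
    have hg : ozGain x κ₁ κ₂ a b n (t + 1) = ![κ₁ * a ^ t, -(κ₂ * (-b) ^ t)] := by
      simp [ozGain, show t < n by omega]
    rw [hg]
    have e₁ : (κ₁ * a ^ t) * (κ₁ * a ^ t) = P₁ * (1 - ρ ^ 2) * g * (a ^ 2) ^ t := by
      rw [← h₁]; ring
    have e₂ : (κ₂ * (-b) ^ t) * (κ₂ * (-b) ^ t) = P₂ * (1 - ρ ^ 2) * g * (b ^ 2) ^ t := by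
      rw [← h₂, mul_mul_mul_comm, ← mul_pow]; ring
    have e₁₂ : (κ₁ * a ^ t) * (κ₂ * (-b) ^ t) = κ₁ * κ₂ * (-(a * b)) ^ t := by
      rw [mul_mul_mul_comm, ← mul_pow]; ring
    have f₁₂ : ρ * g * (-(a * b)) ^ t + N⁻¹ * -(κ₁ * κ₂ * (-(a * b)) ^ t) =
        ρ * g * (-(a * b)) ^ (t + 1) := by
      have : ρ * g * (-(a * b)) ^ t + N⁻¹ * -(κ₁ * κ₂ * (-(a * b)) ^ t) =
        (ρ * g - κ₁ * κ₂ / N) * (-(a * b)) ^ t := by ring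
      rw [this, h₁₂]; ring
    ext i j
    fin_cases i <;> fin_cases j
    · simp [e₁]
      rw [pow_succ (a ^ 2), ha]; ring
    · simp [e₁₂]
      linarith [f₁₂]
    · simp
      rw [mul_comm (κ₂ * _), e₁₂]
      linarith [f₁₂]
    · simp [e₂]
      rw [pow_succ (b ^ 2), hb]; ring

lemma precision_add_of_zero {N : ℝ} {α : ℕ → Fin 2 → ℝ} {t₀ : ℕ} (h : ∀ t ≥ t₀, α t = 0) (k : ℕ) :
    precision N α (t₀ + k) = precision N α t₀ := by
  induction k with
  | zero => rfl
  | succ k ih =>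
    rw [← add_assoc, precision_succ, ih, h _ (by omega)]
    ext i j
    simp

lemma inv_diag {W : Matrix (Fin 2) (Fin 2) ℝ} : W⁻¹ 0 0 = W 1 1 / W.det ∧
    W⁻¹ 1 1 = W 0 0 / W.det := by
  rw [Matrix.inv_def, Matrix.adjugate_fin_two]
  simp [div_eq_inv_mul]

/-- `RhoEq` in the form that makes the correlation stationary. Squaring both sides reduces it to
`RhoEq`; the sign of the right side is settled separately. -/
lemma RhoEq.mul_sqrt_eq {P₁ P₂ N ρ : ℝ} (h : RhoEq P₁ P₂ N ρ) (hP₁ : 0 < P₁) (hP₂ : 0 < P₂)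
    (hN : 0 < N) (hρ : ρ ∈ Set.Ioo (0 : ℝ) 1) :
    ρ * (√(1 + P₁ * (1 - ρ ^ 2) / N) * √(1 + P₂ * (1 - ρ ^ 2) / N)) =
      √(P₁ * P₂) * (1 - ρ ^ 2) / N - ρ := by
  have hρ0 := hρ.1
  have hq : 0 < 1 - ρ ^ 2 := by nlinarith [hρ.1, hρ.2]
  have hs0 : 0 < √(P₁ * P₂) := Real.sqrt_pos.2 (mul_pos hP₁ hP₂)
  have hs2 : √(P₁ * P₂) ^ 2 = P₁ * P₂ := Real.sq_sqrt (mul_pos hP₁ hP₂).le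
  set s := √(P₁ * P₂)
  set q := 1 - ρ ^ 2 with hqdef
  have hE : s ^ 2 * q ^ 2 = N * ρ ^ 2 * (P₁ + P₂) + 2 * s * ρ * N := by
    unfold RhoEq at h
    rw [hs2]
    have : ρ ^ 2 = 1 - q := by rw [hqdef]; ring
    rw [this]
    linarith
  have hsq : ρ ^ 2 * ((N + P₁ * q) * (N + P₂ * q)) = (s * q - ρ * N) ^ 2 := by
    have h1 : ρ ^ 2 * (P₁ * P₂ * q ^ 2) = (1 - q) * (s ^ 2 * q ^ 2) := by
      rw [hs2, hqdef]; ring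
    have h2 : ρ ^ 2 * ((N + P₁ * q) * (N + P₂ * q)) =
      ρ ^ 2 * N ^ 2 + ρ ^ 2 * N * q * (P₁ + P₂) + ρ ^ 2 * (P₁ * P₂ * q ^ 2) := by ring
    have h3 : q * (s ^ 2 * q ^ 2) = q * (N * ρ ^ 2 * (P₁ + P₂) + 2 * s * ρ * N) := by rw [hE]
    rw [h2, h1]
    linarith
  -- Were this negative, its square would be at most `(ρ N)²`, while the left side of `hsq` exceeds
  -- `(ρ N)²`.
  have hpos : 0 ≤ s * q - ρ * N := by
    by_contra hcon
    push Not at hcon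
    have h1 : (s * q - ρ * N) ^ 2 ≤ (ρ * N) ^ 2 := by
      have : 0 < s * q := by positivity
      nlinarith
    have h2 : (ρ * N) ^ 2 < ρ ^ 2 * ((N + P₁ * q) * (N + P₂ * q)) := by
      rw [mul_pow]
      have : N ^ 2 < (N + P₁ * q) * (N + P₂ * q) := by
        have := mul_pos hP₁ hq
        have := mul_pos hP₂ hq
        nlinarith
      gcongr
    linarith
  have hr : (0 : ℝ) ≤ s * q / N - ρ := by
    have : s * q / N - ρ = (s * q - ρ * N) / N := by field_simp
    rw [this]; positivity
  have hv : ρ ^ 2 * ((1 + P₁ * q / N) * (1 + P₂ * q / N)) = (s * q / N - ρ) ^ 2 := by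
    have e1 : (1 + P₁ * q / N) * (1 + P₂ * q / N) = (N + P₁ * q) * (N + P₂ * q) / N ^ 2 := by
      field_simp
    have e2 : (s * q / N - ρ) ^ 2 = (s * q - ρ * N) ^ 2 / N ^ 2 := by field_simp
    rw [e1, e2, ← hsq]; ring
  rw [← Real.sqrt_sq hr, ← hv, Real.sqrt_mul (sq_nonneg ρ), Real.sqrt_sq hρ0.le,
    Real.sqrt_mul (x := 1 + P₁ * q / N) (by positivity)]

lemma tendsto_rate (C l : ℝ) (k : ℕ) :
    Filter.Tendsto (fun n : ℕ => 1 / (2 * ((n + 1 + k : ℕ) : ℝ)) * (C + n * l)) Filter.atTop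
      (𝓝 (1 / 2 * l)) := by
  have h0 : Filter.Tendsto (fun n : ℕ => 1 / (((n + (1 + k) : ℕ) : ℝ))) Filter.atTop (𝓝 0) :=
    (tendsto_one_div_atTop_nhds_zero_nat (𝕜 := ℝ)).comp (Filter.tendsto_add_atTop_nat (1 + k))
  have h1 := (h0.const_mul ((C - (1 + k) * l) / 2)).add_const (1 / 2 * l)
  simp only [mul_zero, zero_add] at h1
  refine h1.congr fun n => ?_
  have : ((n + 1 + k : ℕ) : ℝ) ≠ 0 := by positivity
  rw [← add_assoc]
  field_simp
  push_cast
  ring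

set_option maxHeartbeats 1000000 in
/-- For positive powers, linear feedback schemes without feedback noise come arbitrarily close to
the operating point whose correlation solves `RhoEq`, with strict slack in the power constraints. -/
lemma exists_errorScheme {P₁ P₂ N ρ : ℝ} (hP₁ : 0 < P₁) (hP₂ : 0 < P₂) (hN : 0 < N)
    (hρ : ρ ∈ Set.Ioo (0 : ℝ) 1) (h : RhoEq P₁ P₂ N ρ) {c : ℝ} (hc : c < 1) :
    ∃ (η : ℕ) (p : Params η), 0 < η ∧
      ((p.inputCov N 0).submatrix (Prod.mk 0) (Prod.mk 0)).trace < η * P₁ ∧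
      ((p.inputCov N 0).submatrix (Prod.mk 1) (Prod.mk 1)).trace < η * P₂ ∧
      (p.C * p.Cᵀ).det ≠ 0 ∧
      c * (1 / 2 * Real.log (1 + P₁ * (1 - ρ ^ 2) / N)) <
        p.rateBound N 0 p.C (Matrix.vecMulVec (p.a 0) (p.a 0)) ∧
      c * (1 / 2 * Real.log (1 + P₂ * (1 - ρ ^ 2) / N)) <
        p.rateBound N 0 p.C (Matrix.vecMulVec (p.a 1) (p.a 1)) ∧
      c * (1 / 2 * Real.log (1 + P₁ * (1 - ρ ^ 2) / N)) +
        c * (1 / 2 * Real.log (1 + P₂ * (1 - ρ ^ 2) / N)) <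
        p.rateBound N 0 p.C (p.Ab * p.Abᵀ) := by
  have hkey := h.mul_sqrt_eq hP₁ hP₂ hN hρ
  have hρ0 := hρ.1
  have hρ1 : 0 < 1 - ρ := by linarith [hρ.2]
  have hq : 0 < 1 - ρ ^ 2 := by nlinarith [hρ.1, hρ.2]
  set q := 1 - ρ ^ 2 with hqdef
  set lam₁ := 1 + P₁ * q / N
  set lam₂ := 1 + P₂ * q / N
  have hlam₁ : 1 < lam₁ := lt_add_of_pos_right _ (by positivity)
  have hlam₂ : 1 < lam₂ := lt_add_of_pos_right _ (by positivity)
  set a := √lam₁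
  set b := √lam₂
  have ha : a ^ 2 = lam₁ := Real.sq_sqrt (by linarith)
  have hb : b ^ 2 = lam₂ := Real.sq_sqrt (by linarith)
  -- `g` and `x` solve `1 + x² / N = g` and `x² / N = ρ g`, so the first use creates the required
  -- precision matrix. Below, `κ₁` and `κ₂` are fixed by the powers being `P₁` and `P₂` in every
  -- later use.
  set g := 1 / (1 - ρ) with hg
  have hg0 : 0 < g := by positivity
  set x := √(N * ρ / (1 - ρ))
  have hx : x ^ 2 = N * ρ / (1 - ρ) := Real.sq_sqrt (by positivity)
  set κ₁ := √(P₁ * q * g)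
  set κ₂ := √(P₂ * q * g)
  have hκ₁ : κ₁ ^ 2 = P₁ * q * g := Real.sq_sqrt (by positivity)
  have hκ₂ : κ₂ ^ 2 = P₂ * q * g := Real.sq_sqrt (by positivity)
  have hκ : κ₁ * κ₂ = √(P₁ * P₂) * q * g := by
    rw [← Real.sqrt_mul (by positivity)]
    have : P₁ * q * g * (P₂ * q * g) = (P₁ * P₂) * (q * g) ^ 2 := by ring
    rw [this, Real.sqrt_mul (by positivity), Real.sqrt_sq (by positivity)]
    ring
  have h₁₂ : ρ * g - κ₁ * κ₂ / N = -(ρ * g * (a * b)) := by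
    have : ρ * g * (a * b) = g * (ρ * (a * b)) := by ring
    rw [this, hkey, hκ]
    ring
  have hprec := precision_ozGain (N := N) (x := x) (g := g) (κ₁ := κ₁) (κ₂ := κ₂) (a := a) (b := b)
    (ρ := ρ) (P₁ := P₁) (P₂ := P₂) (by rw [hx, hg]; field_simp; ring)
    (by rw [hx, hg]; field_simp) hκ₁ hκ₂ ha hb h₁₂
  rw [ha, hb] at hprec
  have hdetP : ∀ n t, t ≤ n → (precision N (ozGain x κ₁ κ₂ a b n) (t + 1)).det =
      g ^ 2 * q * (lam₁ ^ t * lam₂ ^ t) := by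
    intro n t ht
    rw [hprec n t ht, Matrix.det_fin_two_of]
    have : (-(a * b)) ^ t * (-(a * b)) ^ t = lam₁ ^ t * lam₂ ^ t := by
      rw [← mul_pow, ← mul_pow, ← ha, ← hb]; ring
    calc g * lam₁ ^ t * (g * lam₂ ^ t) - ρ * g * (-(a * b)) ^ t * (ρ * g * (-(a * b)) ^ t)
        = g ^ 2 * (lam₁ ^ t * lam₂ ^ t) -
          ρ ^ 2 * g ^ 2 * ((-(a * b)) ^ t * (-(a * b)) ^ t) := by ring
      _ = _ := by rw [this, hqdef]; ring
  -- The first use costs power `x²`, possibly above the budget; `k` silent uses at the end pay for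
  -- it and leave strict slack.
  obtain ⟨k, hk⟩ := exists_nat_gt (x ^ 2 / min P₁ P₂)
  have hk' : x ^ 2 < k * min P₁ P₂ := (div_lt_iff₀ (lt_min hP₁ hP₂)).1 hk
  have hkP : ∀ P, min P₁ P₂ ≤ P → x ^ 2 < k * P := fun P hP =>
    hk'.trans_le (mul_le_mul_of_nonneg_left hP (by positivity))
  have hzero : ∀ n t, n + 1 ≤ t → ozGain x κ₁ κ₂ a b n t = 0 := by
    intro n t ht
    obtain ⟨t, rfl⟩ : ∃ j, t = j + 1 := ⟨t - 1, by omega⟩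
    simp [ozGain, show ¬ t < n by omega]
  have htrace : ∀ n (ν : Fin 2), (((errorScheme N (ozGain x κ₁ κ₂ a b n)
      (n + 1 + k)).inputCov N 0).submatrix (Prod.mk ν) (Prod.mk ν)).trace =
      x ^ 2 + n * (![P₁, P₂] ν) := by
    intro n ν
    rw [Matrix.trace]
    simp only [Matrix.diag_apply, Matrix.submatrix_apply, inputCov_errorScheme_diag _ hN]
    rw [Fin.sum_univ_eq_sum_range (fun i => ozGain x κ₁ κ₂ a b n i ν ^ 2 *
      (precision N (ozGain x κ₁ κ₂ a b n) i)⁻¹ ν ν) (n + 1 + k), Finset.sum_range_add,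
      Finset.sum_range_succ']
    have z : ∑ i ∈ Finset.range k, ozGain x κ₁ κ₂ a b n (n + 1 + i) ν ^ 2 *
        (precision N (ozGain x κ₁ κ₂ a b n) (n + 1 + i))⁻¹ ν ν = 0 :=
      Finset.sum_eq_zero fun i _ => by rw [hzero n _ (by omega)]; simp
    have f : ozGain x κ₁ κ₂ a b n 0 ν ^ 2 *
        (precision N (ozGain x κ₁ κ₂ a b n) 0)⁻¹ ν ν = x ^ 2 := by
      fin_cases ν <;> simp [ozGain, precision]
    have m : ∀ t ∈ Finset.range n, ozGain x κ₁ κ₂ a b n (t + 1) ν ^ 2 *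
        (precision N (ozGain x κ₁ κ₂ a b n) (t + 1))⁻¹ ν ν = ![P₁, P₂] ν := by
      intro t ht
      have htn := Finset.mem_range.1 ht
      have hd := hdetP n t htn.le
      have hL₁ : 0 < lam₁ ^ t := by positivity
      have hL₂ : 0 < lam₂ ^ t := by positivity
      have hb2 : ((-b) ^ t) ^ 2 = lam₂ ^ t := by rw [← pow_mul, mul_comm, pow_mul, neg_sq, hb]
      have ha2 : (a ^ t) ^ 2 = lam₁ ^ t := by rw [← pow_mul, mul_comm, pow_mul, ha]
      fin_cases ν
      · simp only [Fin.zero_eta]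
        rw [inv_diag.1, hd, hprec n t htn.le]
        simp only [ozGain, htn, if_true]
        simp
        rw [mul_pow, hκ₁, ha2]
        field_simp
      · simp only [Fin.mk_one]
        rw [inv_diag.2, hd, hprec n t htn.le]
        simp only [ozGain, htn, if_true]
        simp
        rw [mul_pow, hκ₂, hb2]
        field_simp
    rw [z, f, Finset.sum_congr rfl m]
    simp
    ring
  have hprecη : ∀ n, precision N (ozGain x κ₁ κ₂ a b n) (n + 1 + k) =
      precision N (ozGain x κ₁ κ₂ a b n) (n + 1) := fun n =>
    precision_add_of_zero (hzero n) k
  have hpow : ∀ l : ℝ, 1 < l → ∀ᶠ n : ℕ in Filter.atTop, 2 / (g * q) ≤ l ^ n := fun l hl =>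
    (tendsto_pow_atTop_atTop_of_one_lt hl).eventually_ge_atTop _
  have hI₁ : 0 < 1 / 2 * Real.log lam₁ := by have := Real.log_pos hlam₁; positivity
  have hI₂ : 0 < 1 / 2 * Real.log lam₂ := by have := Real.log_pos hlam₂; positivity
  have ev₁ := (tendsto_rate (Real.log g) (Real.log lam₁) k).eventually_const_lt
    (mul_lt_of_lt_one_left hI₁ hc)
  have ev₂ := (tendsto_rate (Real.log g) (Real.log lam₂) k).eventually_const_lt
    (mul_lt_of_lt_one_left hI₂ hc)
  have ev₃ := (tendsto_rate (Real.log (g ^ 2 * q)) (Real.log lam₁ + Real.log lam₂)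
    k).eventually_const_lt (u := c * (1 / 2 * Real.log lam₁) + c * (1 / 2 * Real.log lam₂)) (by
      have h1 := mul_lt_of_lt_one_left hI₁ hc
      have h2 := mul_lt_of_lt_one_left hI₂ hc
      linarith)
  obtain ⟨n, e₁, e₂, e₃, p₁, p₂⟩ := (ev₁.and (ev₂.and (ev₃.and ((hpow _ hlam₁).and
    (hpow _ hlam₂))))).exists
  have hL₁ : 0 < lam₁ ^ n := by positivity
  have hL₂ : 0 < lam₂ ^ n := by positivity
  have e00 : precision N (ozGain x κ₁ κ₂ a b n) (n + 1) 0 0 = g * lam₁ ^ n := by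
    rw [hprec n n le_rfl]; rfl
  have e11 : precision N (ozGain x κ₁ κ₂ a b n) (n + 1) 1 1 = g * lam₂ ^ n := by
    rw [hprec n n le_rfl]; rfl
  -- Here `det (G - 1) = det G - tr G + 1`, and for large `n` the lower bounds `p₁` and `p₂` give
  -- `det G ≥ tr G`.
  have hdet : ((errorScheme N (ozGain x κ₁ κ₂ a b n) (n + 1 + k)).C *
      (errorScheme N (ozGain x κ₁ κ₂ a b n) (n + 1 + k)).Cᵀ).det ≠ 0 := by
    rw [C_mul_C_transpose _ hN, hprecη, Matrix.det_smul]
    refine mul_ne_zero (pow_ne_zero _ hN.ne') (ne_of_gt ?_)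
    have hd := hdetP n n le_rfl
    rw [Matrix.det_fin_two] at hd ⊢
    simp only [Matrix.sub_apply, Matrix.one_apply]
    simp
    rw [e00, e11] at hd ⊢
    have hgq : 0 < g * q := by positivity
    rw [div_le_iff₀ hgq] at p₁ p₂
    have u₁ := mul_le_mul_of_nonneg_left p₁ (mul_pos hg0 hL₂).le
    have u₂ := mul_le_mul_of_nonneg_left p₂ (mul_pos hg0 hL₁).le
    nlinarith
  refine ⟨n + 1 + k, errorScheme N (ozGain x κ₁ κ₂ a b n) (n + 1 + k), by omega, ?_, ?_, hdet,
    ?_, ?_, ?_⟩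
  · rw [htrace]
    have := hkP P₁ (min_le_left _ _)
    simp only [Matrix.cons_val_zero]
    push_cast
    linarith
  · rw [htrace]
    have := hkP P₂ (min_le_right _ _)
    simp only [Matrix.cons_val_one]
    push_cast
    linarith
  · rw [rateBound_single _ hN hdet, hprecη, e00, Real.log_mul hg0.ne' hL₁.ne',
      Real.log_pow]
    exact e₁
  · rw [rateBound_single _ hN hdet, hprecη, e11, Real.log_mul hg0.ne' hL₂.ne',
      Real.log_pow]
    exact e₂
  · rw [rateBound_joint _ hN hdet, hprecη, hdetP n n le_rfl,
      Real.log_mul (by positivity) (by positivity), Real.log_mul hL₁.ne' hL₂.ne', Real.log_pow,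
      Real.log_pow, ← mul_add (n : ℝ)]
    exact e₃

/-! ### Vanishing feedback noise -/

section continuity

variable {η : ℕ} (p : Params η)

lemma continuous_kronecker_one :
    Continuous fun K : Matrix (Fin 2) (Fin 2) ℝ => K ⊗ₖ (1 : Matrix (Fin η) (Fin η) ℝ) := by
  refine continuous_matrix fun i j => ?_
  simp only [Matrix.kroneckerMap_apply]
  fun_prop

lemma continuous_noiseCov (N : ℝ) : Continuous fun K => p.noiseCov N K := by
  have := continuous_kronecker_one (η := η)
  unfold Params.noiseCov
  fun_prop

lemma continuous_inputCov (N : ℝ) : Continuous fun K => p.inputCov N K := by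
  have := continuous_kronecker_one (η := η)
  unfold Params.inputCov
  fun_prop

/-- A nonzero rate certifies that neither determinant vanishes at `K = 0`, because division by zero
and `Real.log 0` both return zero. -/
lemma continuousAt_rateBound {N : ℝ} {k : ℕ} {D : Matrix (Fin k) (Fin η) ℝ}
    {S : Matrix (Fin η) (Fin η) ℝ} (h : p.rateBound N 0 D S ≠ 0) :
    ContinuousAt (fun K => p.rateBound N K D S) 0 := by
  have hc := continuous_noiseCov p N
  have hne : (D * (S + p.noiseCov N 0) * Dᵀ).det / (D * p.noiseCov N 0 * Dᵀ).det ≠ 0 := by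
    intro h0
    exact h (by rw [Params.rateBound, h0]; simp)
  have h1 : Continuous fun K => (D * (S + p.noiseCov N K) * Dᵀ).det := by fun_prop
  have h2 : Continuous fun K => (D * p.noiseCov N K * Dᵀ).det := by fun_prop
  exact continuousAt_const.mul
    ((h1.continuousAt.div h2.continuousAt (div_ne_zero_iff.1 hne).2).log hne)

lemma nfBound_of_noiseCov_eq (hη : 0 < η) {P' N : ℝ} (hN : 0 < N)
    {K : Matrix (Fin 2) (Fin 2) ℝ} (hK : p.noiseCov N K = N • 1) :
    p.nfBound P' N K = 1 / 2 * Real.log (1 + P' / N) := by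
  have hη' : (η : ℝ) ≠ 0 := by positivity
  rw [Params.nfBound, hK, ← add_smul, Matrix.det_smul, Matrix.det_smul, Matrix.det_one,
    Fintype.card_fin, mul_one, mul_one, ← div_pow, Real.log_pow]
  have : (P' + N) / N = 1 + P' / N := by field_simp; ring
  rw [this]
  field_simp

lemma eventually_le_nfBound (hη : 0 < η) {P' N c : ℝ} (hP' : 0 ≤ P') (hN : 0 < N) (hc : c < 1) :
    ∀ᶠ K in 𝓝 0, c * (1 / 2 * Real.log (1 + P' / N)) ≤ p.nfBound P' N K := by
  -- At `P' = 0` there is no strict slack, but both sides are zero: the quotient is one, or zero by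
  -- the convention for `0 / 0`, and its logarithm vanishes either way.
  rcases hP'.eq_or_lt with rfl | hpos
  · refine Filter.Eventually.of_forall fun K => ?_
    simp only [Params.nfBound, zero_smul, zero_add, zero_div, add_zero, Real.log_one, mul_zero]
    by_cases h : (p.noiseCov N K).det = 0
    · simp [h]
    · simp [div_self h]
  · have h0 := nfBound_of_noiseCov_eq p hη (P' := P') hN (noiseCov_zero p N)
    have hI : 0 < 1 / 2 * Real.log (1 + P' / N) := by
      have : 0 < P' / N := by positivity
      have := Real.log_pos (show 1 < 1 + P' / N by linarith)
      positivity
    have hcont := continuous_noiseCov p N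
    have h1 : Continuous fun K =>
        (P' • (1 : Matrix (Fin η) (Fin η) ℝ) + p.noiseCov N K).det := by fun_prop
    have h2 : Continuous fun K => (p.noiseCov N K).det := by fun_prop
    have hne : (P' • (1 : Matrix (Fin η) (Fin η) ℝ) + p.noiseCov N 0).det /
        (p.noiseCov N 0).det ≠ 0 := by
      intro h
      rw [Params.nfBound, h] at h0
      simp only [Real.log_zero, mul_zero] at h0
      exact hI.ne h0
    have hat : ContinuousAt (fun K => p.nfBound P' N K) 0 := continuousAt_const.mul
      ((h1.continuousAt.div h2.continuousAt (div_ne_zero_iff.1 hne).2).log hne)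
    have hlt : c * (1 / 2 * Real.log (1 + P' / N)) < p.nfBound P' N 0 := by
      rw [h0]; exact mul_lt_of_lt_one_left hI hc
    filter_upwards [hat.eventually (lt_mem_nhds hlt)] with K hK using hK.le

end continuity

/-- Schemes that are, for all small feedback-noise covariances, close to the operating point whose
correlation solves `RhoEq`. -/
lemma exists_eventually_region {P₁ P₂ P' N ρ c : ℝ} (hP₁ : 0 < P₁) (hP₂ : 0 < P₂) (hP' : 0 ≤ P')
    (hN : 0 < N) (hρ : ρ ∈ Set.Ioo (0 : ℝ) 1) (h : RhoEq P₁ P₂ (N + P') ρ)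
    (hc : c ∈ Set.Ico (0 : ℝ) 1) :
    ∃ (η : ℕ) (p : Params η), 0 < η ∧ ∀ᶠ K in 𝓝 0,
      p.TraceConstraints P₁ P₂ (N + P') K ∧
      (∀ r₁ r₂ : ℝ, 0 ≤ r₁ → 0 ≤ r₂ →
        r₁ ≤ c * (1 / 2 * Real.log (1 + P₁ * (1 - ρ ^ 2) / (N + P'))) →
        r₂ ≤ c * (1 / 2 * Real.log (1 + P₂ * (1 - ρ ^ 2) / (N + P'))) →
        (r₁, r₂) ∈ p.region (N + P') K) ∧
      c * (1 / 2 * Real.log (1 + P' / N)) ≤ p.nfBound P' N K := by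
  have hN' : 0 < N + P' := by linarith
  obtain ⟨η, p, hη, t₁, t₂, hdet, b₁, b₂, b₃⟩ := exists_errorScheme hP₁ hP₂ hN' hρ h hc.2
  have hq : 0 ≤ 1 - ρ ^ 2 := by nlinarith [hρ.1, hρ.2]
  have hI : ∀ P, 0 < P → 0 ≤ c * (1 / 2 * Real.log (1 + P * (1 - ρ ^ 2) / (N + P'))) := by
    intro P hP
    have : 0 ≤ P * (1 - ρ ^ 2) / (N + P') := by positivity
    have := Real.log_nonneg (show 1 ≤ 1 + P * (1 - ρ ^ 2) / (N + P') by linarith)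
    have := hc.1
    positivity
  refine ⟨η, p, hη, ?_⟩
  have hcov := continuous_inputCov p (N + P')
  have htr : ∀ ν : Fin 2, Continuous fun K =>
      ((p.inputCov (N + P') K).submatrix (Prod.mk ν) (Prod.mk ν)).trace := fun ν => by fun_prop
  have ev {f : Matrix (Fin 2) (Fin 2) ℝ → ℝ} {x : ℝ} (hf : ContinuousAt f 0) (hx : x < f 0) :
      ∀ᶠ K in 𝓝 0, x < f K := hf.eventually (lt_mem_nhds hx)
  have c₁ := continuousAt_rateBound p ((hI P₁ hP₁).trans_lt b₁).ne'
  have c₂ := continuousAt_rateBound p ((hI P₂ hP₂).trans_lt b₂).ne'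
  have c₃ := continuousAt_rateBound p ((add_nonneg (hI P₁ hP₁) (hI P₂ hP₂)).trans_lt b₃).ne'
  filter_upwards [(htr 0).continuousAt.eventually (gt_mem_nhds t₁),
    (htr 1).continuousAt.eventually (gt_mem_nhds t₂), ev c₁ b₁, ev c₂ b₂, ev c₃ b₃,
    eventually_le_nfBound p hη hP' hN hc.2] with K u₁ u₂ v₁ v₂ v₃ w
  refine ⟨⟨u₁.le, u₂.le⟩, fun r₁ r₂ h₁ h₂ l₁ l₂ => Or.inl ⟨hdet, h₁, h₂, ?_, ?_, ?_⟩, w⟩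
  · exact l₁.trans v₁.le
  · exact l₂.trans v₂.le
  · exact (add_le_add l₁ l₂).trans v₃.le

/-- The trace of a positive semidefinite matrix bounds all its entries, the off-diagonal one through
the nonnegative determinant, so small trace means close to zero. -/
lemma exists_forall_posSemidef {Pr : Matrix (Fin 2) (Fin 2) ℝ → Prop}
    (h : ∀ᶠ K in 𝓝 0, Pr K) :
    ∃ σsq > 0, ∀ K : Matrix (Fin 2) (Fin 2) ℝ, K.PosSemidef → K.trace ≤ σsq → Pr K := by
  have h' : ∀ᶠ K in 𝓝 (0 : Fin 2 → Fin 2 → ℝ), Pr (Matrix.of K) := h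
  obtain ⟨ε, hε, hball⟩ := Metric.eventually_nhds_iff.1 h'
  refine ⟨ε / 2, by positivity, fun K hK htr => ?_⟩
  refine hball (y := fun i j => K i j) ?_
  rw [Matrix.trace_fin_two] at htr
  have h0 := hK.diag_nonneg (i := 0)
  have h1 := hK.diag_nonneg (i := 1)
  have hd := hK.det_nonneg
  rw [Matrix.det_fin_two] at hd
  have hsym : K 1 0 = K 0 1 := by
    have := hK.isHermitian.apply 0 1
    simpa using this
  have hoff : |K 0 1| ≤ K 0 0 + K 1 1 := by
    refine abs_le_of_sq_le_sq ?_ (by linarith)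
    rw [hsym] at hd
    nlinarith
  rw [dist_pi_lt_iff hε]
  intro i
  rw [dist_pi_lt_iff hε]
  intro j
  rw [Real.dist_eq]
  fin_cases i <;> fin_cases j <;> simp [hsym, abs_of_nonneg h0, abs_of_nonneg h1] <;> linarith

/-- The points `c R` lie in the union over `σ²` for each `c < 1` and tend to `R`. The threshold on
the noise may depend on `c`. -/
lemma mem_vanishingNoiseLimit {F : Matrix (Fin 2) (Fin 2) ℝ → Set (ℝ × ℝ)} {R : ℝ × ℝ}
    (h : ∀ c ∈ Set.Ico (0 : ℝ) 1, ∀ᶠ K in 𝓝 0, (c * R.1, c * R.2) ∈ F K) :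
    R ∈ vanishingNoiseLimit F := by
  have hlim : Filter.Tendsto (fun c : ℝ => (c * R.1, c * R.2)) (𝓝[<] 1) (𝓝 R) := by
    have : Continuous fun c : ℝ => (c * R.1, c * R.2) := by fun_prop
    have h := this.tendsto 1
    simp only [one_mul, Prod.mk.eta] at h
    exact h.mono_left nhdsWithin_le_nhds
  refine mem_closure_of_tendsto hlim ?_
  filter_upwards [Ico_mem_nhdsLT (zero_lt_one' ℝ)] with c hc
  obtain ⟨σsq, hσ, hK⟩ := exists_forall_posSemidef (h c hc)
  simp only [Set.mem_iUnion, Set.mem_iInter]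
  exact ⟨σsq, hσ, fun K hKm => hK K hKm.1 hKm.2⟩

/-- Splitting a rate below `c (I + J)` into rates below `c I` and `c J`. -/
lemma exists_rate_split {c R I J : ℝ} (hc : 0 ≤ c) (hR : 0 ≤ R) (hI : 0 ≤ I) (hJ : 0 ≤ J)
    (h : R ≤ I + J) :
    ∃ s t : ℝ, 0 ≤ s ∧ 0 ≤ t ∧ s + t = c * R ∧ s ≤ c * I ∧ t ≤ c * J := by
  rcases le_total R I with hle | hle
  · exact ⟨c * R, 0, by positivity, le_rfl, by ring, mul_le_mul_of_nonneg_left hle hc,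
      by positivity⟩
  · exact ⟨c * I, c * (R - I), by positivity, mul_nonneg hc (by linarith), by ring,
      le_rfl, mul_le_mul_of_nonneg_left (by linarith) hc⟩

/-! ### Uncoded transmission without feedback -/

/-- The scheme of length one in which user `ν` sends its symbol with amplitude `a ν`. -/
def plainScheme (a : Fin 2 → ℝ) : Params 1 where
  a ν _ := a ν
  B _ := 0
  C := Matrix.of fun _ _ => 1
  strictLower _ _ _ _ := rfl

lemma noiseCov_plainScheme (a : Fin 2 → ℝ) (N : ℝ) (K : Matrix (Fin 2) (Fin 2) ℝ) :
    (plainScheme a).noiseCov N K = N • 1 := by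
  have : (plainScheme a).Bb = 0 := by ext i y; simp [Params.Bb, plainScheme]
  simp [Params.noiseCov, this]

lemma traceConstraints_plainScheme {a : Fin 2 → ℝ} {P₁ P₂ : ℝ} (h₁ : a 0 ^ 2 ≤ P₁)
    (h₂ : a 1 ^ 2 ≤ P₂) (N : ℝ) (K : Matrix (Fin 2) (Fin 2) ℝ) :
    (plainScheme a).TraceConstraints P₁ P₂ N K := by
  have e₁ : (plainScheme a).BB = 0 := by ext x y; simp [Params.BB, plainScheme]
  have e₂ : (plainScheme a).Bt = 0 := by ext x y; simp [Params.Bt, plainScheme]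
  have e₃ : (plainScheme a).Bd = 0 := by ext x y; simp [Params.Bd, plainScheme]
  have e : (plainScheme a).inputCov N K = (plainScheme a).Ad * (plainScheme a).Adᵀ := by
    simp [Params.inputCov, e₁, e₂, e₃]
  rw [Params.TraceConstraints, e]
  constructor
  · simpa [Matrix.trace, Matrix.mul_apply, Params.Ad, plainScheme, ← sq] using h₁
  · simpa [Matrix.trace, Matrix.mul_apply, Params.Ad, plainScheme, ← sq] using h₂

lemma mem_region_plainScheme {a : Fin 2 → ℝ} {N : ℝ} {R : ℝ × ℝ} (h₁ : 0 ≤ R.1)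
    (h₂ : 0 ≤ R.2) (b₁ : R.1 ≤ 1 / 2 * Real.log ((a 0 ^ 2 + N) / N))
    (b₂ : R.2 ≤ 1 / 2 * Real.log ((a 1 ^ 2 + N) / N))
    (b₃ : R.1 + R.2 ≤ 1 / 2 * Real.log ((a 0 ^ 2 + a 1 ^ 2 + N) / N))
    (K : Matrix (Fin 2) (Fin 2) ℝ) : R ∈ (plainScheme a).region N K := by
  have hC : (plainScheme a).C = Matrix.of fun _ _ => 1 := rfl
  have hb : ∀ S : Matrix (Fin 1) (Fin 1) ℝ,
      (plainScheme a).rateBound N K (Matrix.of fun _ : Fin 1 => (plainScheme a).C 0) S =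
      1 / 2 * Real.log ((S 0 0 + N) / N) := by
    intro S
    rw [Params.rateBound, noiseCov_plainScheme]
    simp [hC, Matrix.mul_apply]
  -- `C` has two equal rows, so `C Cᵀ` is singular and the region is computed with a single row.
  refine Or.inr (Or.inl ⟨?_, 0, ?_, h₁, h₂, ?_, ?_, ?_⟩)
  · rw [hC, Matrix.det_fin_two]
    simp [Matrix.mul_apply]
  · intro h
    have := congrFun h 0
    simp [hC] at this
  · rw [hb]
    simpa [Matrix.vecMulVec_apply, plainScheme, ← sq] using b₁
  · rw [hb]
    simpa [Matrix.vecMulVec_apply, plainScheme, ← sq] using b₂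
  · rw [hb]
    simpa [Matrix.mul_apply, Params.Ab, plainScheme, ← sq] using b₃

/-! ### Rate splitting -/

/-- User 1 puts all its power into the non-feedback part, which is noise for user 2. No feedback is
used, so `K` plays no role. -/
lemma rateRS₁_no_cooperation {P₁ P₂ N : ℝ} (hP₁ : 0 < P₁) (hP₂ : 0 < P₂) (hN : 0 < N)
    {R : ℝ × ℝ} (hR : R ∈ ozRect₁ P₁ P₂ N 0) (K : Matrix (Fin 2) (Fin 2) ℝ) :
    R ∈ rateRS₁ P₁ (P₁ - P₁) P₂ N K := by
  obtain ⟨h₁, h₂, b₁, b₂⟩ := hR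
  have hN' : 0 < N + P₁ := by linarith
  have hsq : √P₂ ^ 2 = P₂ := Real.sq_sqrt hP₂.le
  have hlog : R.2 ≤ 1 / 2 * Real.log ((P₂ + (N + P₁)) / (N + P₁)) := by
    refine b₂.trans (le_of_eq ?_)
    congr 3 <;> ring
  refine subset_closure ⟨1, plainScheme ![0, √P₂], one_pos,
    traceConstraints_plainScheme (by simp) (by simp [hsq]) _ _, 0, R.1, le_rfl, h₁, zero_add _,
    mem_region_plainScheme (R := (0, R.2)) le_rfl h₂ ?_ ?_ ?_ K, ?_⟩
  · simp [div_self hN'.ne']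
  · simpa [hsq] using hlog
  · simpa [hsq] using hlog
  · rw [nfBound_of_noiseCov_eq _ one_pos hN (noiseCov_plainScheme _ _ _)]
    simpa using b₁

lemma rateRS₂_no_cooperation {P₁ P₂ N : ℝ} (hP₁ : 0 < P₁) (hP₂ : 0 < P₂) (hN : 0 < N)
    {R : ℝ × ℝ} (hR : R ∈ ozRect₂ P₁ P₂ N 0) (K : Matrix (Fin 2) (Fin 2) ℝ) :
    R ∈ rateRS₂ P₁ P₂ (P₂ - P₂) N K := by
  obtain ⟨h₁, h₂, b₁, b₂⟩ := hR
  have hN' : 0 < N + P₂ := by linarith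
  have hsq : √P₁ ^ 2 = P₁ := Real.sq_sqrt hP₁.le
  have hlog : R.1 ≤ 1 / 2 * Real.log ((P₁ + (N + P₂)) / (N + P₂)) := by
    refine b₁.trans (le_of_eq ?_)
    congr 3 <;> ring
  refine subset_closure ⟨1, plainScheme ![√P₁, 0], one_pos,
    traceConstraints_plainScheme (by simp [hsq]) (by simp) _ _, 0, R.2, le_rfl, h₂, zero_add _,
    mem_region_plainScheme (R := (R.1, 0)) h₁ le_rfl ?_ ?_ ?_ K, ?_⟩
  · simpa [hsq] using hlog
  · simp [div_self hN'.ne']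
  · simpa [hsq] using hlog
  · rw [nfBound_of_noiseCov_eq _ one_pos hN (noiseCov_plainScheme _ _ _)]
    simpa using b₂

/-- The rates of Ozarow's corner point in terms of the power split. -/
lemma ozRect₁_split_rates {P₁ P₂ N ρ Q r : ℝ} (hN : 0 < N)
    (hρ : ρ ∈ Set.Icc (0 : ℝ) 1) (hQ : Q ∈ Set.Ioc 0 P₁) (hr : r ∈ Set.Ioo (0 : ℝ) 1)
    (hQr : Q * r ^ 2 = P₁ * ρ ^ 2) (hsr : √(Q * P₂) * r = √(P₁ * P₂) * ρ)
    (h : RhoEq Q P₂ (N + (P₁ - Q)) r) :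
    1 / 2 * Real.log (1 + P₁ * (1 - ρ ^ 2) / N) =
      1 / 2 * Real.log (1 + Q * (1 - r ^ 2) / (N + (P₁ - Q))) +
        1 / 2 * Real.log (1 + (P₁ - Q) / N) ∧
    (P₁ + P₂ + 2 * √(P₁ * P₂) * ρ + N) / (P₁ * (1 - ρ ^ 2) + N) =
      1 + P₂ * (1 - r ^ 2) / (N + (P₁ - Q)) := by
  have hN' : 0 < N + (P₁ - Q) := by linarith [hQ.2]
  have hq : 0 ≤ 1 - ρ ^ 2 := by nlinarith [hρ.1, hρ.2]
  have hqr : 0 ≤ 1 - r ^ 2 := by nlinarith [hr.1, hr.2]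
  have hQ0 := hQ.1
  constructor
  · have e₁ : 0 < 1 + Q * (1 - r ^ 2) / (N + (P₁ - Q)) := by positivity
    have e₂ : 0 < 1 + (P₁ - Q) / N := by
      have := sub_nonneg.2 hQ.2
      positivity
    rw [← mul_add, ← Real.log_mul e₁.ne' e₂.ne']
    -- The product telescopes through `N + (P₁ - Q)`, since `Q (1 - r²) + (P₁ - Q) = P₁ (1 - ρ²)`.
    congr 2
    field_simp
    linear_combination hQr
  · rw [← h.div_eq hQ0 hN' ⟨hr.1.le, hr.2.le⟩, mul_assoc 2 (√(Q * P₂)), hsr]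
    congr 1
    · ring
    · linear_combination hQr

lemma ozRect₁_subset {P₁ P₂ N ρ : ℝ} (hP₁ : 0 < P₁) (hP₂ : 0 < P₂) (hN : 0 < N)
    (hρ : ρ ∈ Set.Icc 0 (rhoStar P₁ P₂ N)) : ∃ P₁' ∈ Set.Icc 0 P₁, ozRect₁ P₁ P₂ N ρ ⊆
      vanishingNoiseLimit fun K => rateRS₁ P₁' (P₁ - P₁') P₂ N K := by
  rcases hρ.1.eq_or_lt with h0 | hρ0
  · subst h0
    refine ⟨P₁, ⟨hP₁.le, le_rfl⟩, fun R hR => ?_⟩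
    refine subset_closure (Set.mem_biUnion (Set.mem_Ioi.2 one_pos) ?_)
    exact Set.mem_iInter₂.2 fun K _ => rateRS₁_no_cooperation hP₁ hP₂ hN hR K
  obtain ⟨Q, hQ, r, hr, hQr, hsr, hrho⟩ := exists_power_split hP₁ hP₂ hN ⟨hρ0, hρ.2⟩
  have hρ1 : ρ ∈ Set.Icc (0 : ℝ) 1 := ⟨hρ.1, hρ.2.trans (rhoStar_spec hP₁ hP₂ hN).1.2⟩
  obtain ⟨s₁, s₂⟩ := ozRect₁_split_rates hN hρ1 hQ hr hQr hsr hrho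
  have hP' : 0 ≤ P₁ - Q := sub_nonneg.2 hQ.2
  refine ⟨P₁ - Q, ⟨hP', by linarith [hQ.1]⟩, fun R ⟨h₁, h₂, b₁, b₂⟩ => ?_⟩
  rw [sub_sub_cancel]
  rw [s₁] at b₁
  rw [s₂] at b₂
  refine mem_vanishingNoiseLimit fun c hc => ?_
  obtain ⟨η, p, hη, hev⟩ := exists_eventually_region hQ.1 hP₂ hP' hN hr hrho hc
  have hqr : 0 ≤ 1 - r ^ 2 := by nlinarith [hr.1, hr.2]
  have hI : 0 ≤ 1 / 2 * Real.log (1 + Q * (1 - r ^ 2) / (N + (P₁ - Q))) := by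
    have := hQ.1
    exact mul_nonneg (by norm_num) (Real.log_nonneg (le_add_of_nonneg_right (by positivity)))
  have hJ : 0 ≤ 1 / 2 * Real.log (1 + (P₁ - Q) / N) :=
    mul_nonneg (by norm_num) (Real.log_nonneg (le_add_of_nonneg_right (by positivity)))
  obtain ⟨s, t, hs, ht, hst, hs', ht'⟩ := exists_rate_split hc.1 h₁ hI hJ b₁
  filter_upwards [hev] with K ⟨k₁, k₂, k₃⟩
  exact subset_closure ⟨η, p, hη, k₁, s, t, hs, ht, hst,
    k₂ s (c * R.2) hs (mul_nonneg hc.1 h₂) hs' (mul_le_mul_of_nonneg_left b₂ hc.1), ht'.trans k₃⟩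

lemma ozRect₂_subset {P₁ P₂ N ρ : ℝ} (hP₁ : 0 < P₁) (hP₂ : 0 < P₂) (hN : 0 < N)
    (hρ : ρ ∈ Set.Icc 0 (rhoStar P₁ P₂ N)) : ∃ P₂' ∈ Set.Icc 0 P₂, ozRect₂ P₁ P₂ N ρ ⊆
      vanishingNoiseLimit fun K => rateRS₂ P₁ P₂' (P₂ - P₂') N K := by
  rcases hρ.1.eq_or_lt with h0 | hρ0
  · subst h0
    refine ⟨P₂, ⟨hP₂.le, le_rfl⟩, fun R hR => ?_⟩
    refine subset_closure (Set.mem_biUnion (Set.mem_Ioi.2 one_pos) ?_)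
    exact Set.mem_iInter₂.2 fun K _ => rateRS₂_no_cooperation hP₁ hP₂ hN hR K
  -- The power split for user 1 is applied with the users exchanged; `RhoEq` and `ρ*` are symmetric.
  obtain ⟨Q, hQ, r, hr, hQr, hsr, hrho⟩ := exists_power_split hP₂ hP₁ hN
    ⟨hρ0, rhoStar_comm hP₁ hP₂ hN ▸ hρ.2⟩
  have hρ1 : ρ ∈ Set.Icc (0 : ℝ) 1 := ⟨hρ.1, hρ.2.trans (rhoStar_spec hP₁ hP₂ hN).1.2⟩
  obtain ⟨s₁, s₂⟩ := ozRect₁_split_rates hN hρ1 hQ hr hQr hsr hrho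
  have hP' : 0 ≤ P₂ - Q := sub_nonneg.2 hQ.2
  refine ⟨P₂ - Q, ⟨hP', by linarith [hQ.1]⟩, fun R hR => ?_⟩
  rw [ozRect₂_eq] at hR
  obtain ⟨h₂, h₁, b₂, b₁⟩ := hR
  rw [Prod.fst_swap] at h₂ b₂
  rw [Prod.snd_swap] at h₁ b₁
  rw [sub_sub_cancel]
  rw [s₁] at b₂
  rw [s₂] at b₁
  refine mem_vanishingNoiseLimit fun c hc => ?_
  obtain ⟨η, p, hη, hev⟩ := exists_eventually_region hP₁ hQ.1 hP' hN hr hrho.symm hc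
  have hqr : 0 ≤ 1 - r ^ 2 := by nlinarith [hr.1, hr.2]
  have hI : 0 ≤ 1 / 2 * Real.log (1 + Q * (1 - r ^ 2) / (N + (P₂ - Q))) := by
    have := hQ.1
    exact mul_nonneg (by norm_num) (Real.log_nonneg (le_add_of_nonneg_right (by positivity)))
  have hJ : 0 ≤ 1 / 2 * Real.log (1 + (P₂ - Q) / N) :=
    mul_nonneg (by norm_num) (Real.log_nonneg (le_add_of_nonneg_right (by positivity)))
  obtain ⟨s, t, hs, ht, hst, hs', ht'⟩ := exists_rate_split hc.1 h₂ hI hJ b₂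
  filter_upwards [hev] with K ⟨k₁, k₂, k₃⟩
  exact subset_closure ⟨η, p, hη, k₁, s, t, hs, ht, hst,
    k₂ (c * R.1) s (mul_nonneg hc.1 h₁) hs (mul_le_mul_of_nonneg_left b₁ hc.1) hs', ht'.trans k₃⟩

/-- Every boundary point of the perfect-feedback capacity region lies in one of Ozarow's
rectangles. -/
lemma exists_mem_ozRect_of_mem_frontier {P₁ P₂ N : ℝ} (hP₁ : 0 < P₁) (hP₂ : 0 < P₂) (hN : 0 < N)
    {R : ℝ × ℝ} (hR : R ∈ frontier (capPerfectFB P₁ P₂ N)) :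
    ∃ ρ ∈ Set.Icc 0 (rhoStar P₁ P₂ N), R ∈ ozRect₁ P₁ P₂ N ρ ∨ R ∈ ozRect₂ P₁ P₂ N ρ := by
  -- A closed superset of the capacity region contains its frontier, so achievability of the
  -- rectangles is not needed here.
  have hcl : IsClosed ({R : ℝ × ℝ | 0 ≤ R.1 ∧ 0 ≤ R.2} ∩ ozOuter P₁ P₂ N) := by
    refine IsClosed.inter ?_ (isClosed_ozOuter hP₁ hP₂ hN)
    exact (isClosed_le continuous_const continuous_fst).inter
      (isClosed_le continuous_const continuous_snd)
  have hsub : capPerfectFB P₁ P₂ N ⊆ {R : ℝ × ℝ | 0 ≤ R.1 ∧ 0 ≤ R.2} ∩ ozOuter P₁ P₂ N :=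
    fun R hR => ⟨⟨hR.1, hR.2.1⟩, capPerfectFB_subset_ozOuter hP₁ hP₂ hN hR⟩
  obtain ⟨⟨h1, h2⟩, h⟩ := closure_minimal hsub hcl (frontier_subset_closure hR)
  exact exists_mem_ozRect hP₁ hP₂ hN h1 h2 h

end AWGNMAC

end

theorem mainTheorem8 (P₁ P₂ N : ℝ) (hP₁ : 0 < P₁) (hP₂ : 0 < P₂) (hN : 0 < N) :
    (∀ ρ ∈ Set.Icc 0 (AWGNMAC.rhoStar P₁ P₂ N), ∃ P₁' ∈ Set.Icc 0 P₁,
      AWGNMAC.ozRect₁ P₁ P₂ N ρ ⊆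
        AWGNMAC.vanishingNoiseLimit fun K => AWGNMAC.rateRS₁ P₁' (P₁ - P₁') P₂ N K) ∧
    (∀ ρ ∈ Set.Icc 0 (AWGNMAC.rhoStar P₁ P₂ N), ∃ P₂' ∈ Set.Icc 0 P₂,
      AWGNMAC.ozRect₂ P₁ P₂ N ρ ⊆
        AWGNMAC.vanishingNoiseLimit fun K => AWGNMAC.rateRS₂ P₁ P₂' (P₂ - P₂') N K) ∧
    (∀ R ∈ frontier (AWGNMAC.capPerfectFB P₁ P₂ N),
      (∃ P₁' ∈ Set.Icc 0 P₁,
        R ∈ AWGNMAC.vanishingNoiseLimit fun K => AWGNMAC.rateRS₁ P₁' (P₁ - P₁') P₂ N K) ∨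
      (∃ P₂' ∈ Set.Icc 0 P₂,
        R ∈ AWGNMAC.vanishingNoiseLimit fun K => AWGNMAC.rateRS₂ P₁ P₂' (P₂ - P₂') N K)) := by
  refine ⟨fun ρ hρ => AWGNMAC.ozRect₁_subset hP₁ hP₂ hN hρ,
    fun ρ hρ => AWGNMAC.ozRect₂_subset hP₁ hP₂ hN hρ, fun R hR => ?_⟩
  obtain ⟨ρ, hρ, h | h⟩ := AWGNMAC.exists_mem_ozRect_of_mem_frontier hP₁ hP₂ hN hR
  · obtain ⟨P', hP', hsub⟩ := AWGNMAC.ozRect₁_subset hP₁ hP₂ hN hρ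
    exact Or.inl ⟨P', hP', hsub h⟩
  · obtain ⟨P', hP', hsub⟩ := AWGNMAC.ozRect₂_subset hP₁ hP₂ hN hρ
    exact Or.inr ⟨P', hP', hsub h⟩
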